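/- Conventions. $[n]=\{1,\dots,n\}$, and $S_n$ is the group of permutations of $\{1,2,\dots\}$ fixing every $i>n$. Let $\mathbf x=(x_1,x_2,\dots)$, $\mathbf t=(t_1,t_2,\dots)$, and for $f\in\mathbb Z[\mathbf t][\mathbf x]$ and a permutation $\sigma$ put $\operatorname{ev}_\sigma f=f(t_{\sigma(1)},t_{\sigma(2)},\dots;\mathbf t)$. Forests. An indexed forest is a sequence $F=(T_1,T_2,\dots)$ of plane binary trees (every node has an ordered pair of children or is a leaf), all but finitely many consisting of a single leaf; $\emptyset$ is the forest in which all do. The leaves of $F$ are numbered $1,2,\dots$ from left to right, and $\mathsf{Forest}_n$ is the set of forests whose nontrivial trees have all their leaves in $[n]$. An internal node is terminal if both its children are leaves; $\operatorname{QDes}(F)$ is the set of the left leaves of the terminal nodes, and for $i\in\operatorname{QDes}(F)$ the forest $F/i$ is obtained by replacing the terminal node with left leaf $i$ by a leaf. Double forest polynomials. Let $$\mathsf E_if=\frac{f(x_1,\dots,x_{i-1},x_i,t_i,x_{i+1},\dots;\mathbf t)-f(x_1,\dots,x_{i-1},t_i,x_i,x_{i+1},\dots;\mathbf t)}{x_i-t_i}.$$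 The double forest polynomials $\mathfrak P_F\in\mathbb Z[\mathbf t][\mathbf x]$ are the unique family of homogeneous polynomials, indexed by all indexed forests $F$, such that $\mathfrak P_F(\mathbf t;\mathbf t)$ is $1$ if $F=\emptyset$ and $0$ otherwise, and such that $\mathsf E_i\mathfrak P_F=\mathfrak P_{F/i}(\mathbf x;t_1,\dots,t_{i-1},t_{i+1},\dots)$ if $i\in\operatorname{QDes}(F)$ and $\mathsf E_i\mathfrak P_F=0$ otherwise. Noncrossing permutations. A set partition of $[n]$ is noncrossing if there are no $a<c<b<d$ with $a,b$ in one block and $c,d$ in another block. $\mathrm{NC}_n\subset S_n$ is the set of the products, over the blocks $\{a_1<\dots<a_p\}$ of a noncrossing partition of $[n]$, of the cycles $(a_p\,a_{p-1}\cdots a_1)$, i.e. $a_p\mapsto a_{p-1}\mapsto\dots\mapsto a_1\mapsto a_p$. For $\sigma\in \mathrm{NC}_n$ the noncrossing inversion set is $$\operatorname{Inv}_{\mathrm{NC}}(\sigma)=\{(i,j)\in[n]^2 : i<j,\ \sigma\cdot(i\,j)\in \mathrm{NC}_n,\ \sigma(i)>\sigma(j)\}.$$ The map $\operatorname{ForToNC}:\mathsf{Forest}_n\to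 \mathrm{NC}_n$. For each internal node $v$ of $F$ that is the right child of its parent, delete $v$, attach the right child of $v$ in the place of $v$, and let the left child of $v$ become the root of a separate tree. The leaf sets contained in $[n]$ of the resulting trees are the blocks of a noncrossing partition of $[n]$, and $\operatorname{ForToNC}(F)$ is the corresponding element of $\mathrm{NC}_n$. Theorem. Let $F\in\mathsf{Forest}_n$ and $\sigma=\operatorname{ForToNC}(F)$. Then $\sigma\in \mathrm{NC}_n$ and $$\operatorname{ev}_\sigma(\mathfrak P_F)=\prod_{(a,b)\in\operatorname{Inv}_{\mathrm{NC}}(\sigma)}\bigl(t_{\sigma(a)}-t_{\sigma(b)}\bigr).$$ -/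

import Mathlib

/-!
Conventions. The positive integers `1, 2, 3, …` that index leaves and variables are shifted to
`0, 1, 2, … : ℕ`; so the set `[n]` is `Finset.range n`, and the variables are `x 0, x 1, …` and
`t 0, t 1, …`. The symmetric group `S_n` is seen inside the group of permutations of `ℕ`, as the
permutations that fix every `i ≥ n`.
-/

namespace DoubleForest

noncomputable section

/-! ### Binary trees and indexed forests -/

/-- Plane binary trees: each node has two children or none; `nil` is the trivial tree `*`,
i.e. a leaf. -/
abbrev PlaneTree : Type := BinaryTree Unit

/-- Plane binary trees whose leaves are labelled by natural numbers. -/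
inductive LTree : Type
  | leaf (i : ℕ) : LTree
  | node (l r : LTree) : LTree

namespace LTree

/-- The labels of the leaves, from left to right. -/
def leaves : LTree → List ℕ
  | leaf i => [i]
  | node l r => l.leaves ++ r.leaves

/-- The internal nodes of a tree; a node is given by the subtree below it. -/
def internal : LTree → List LTree
  | leaf _ => []
  | node l r => node l r :: (l.internal ++ r.internal)

/-- An internal node is terminal if both of its children are leaves. -/
def IsTerminal (v : LTree) : Prop := ∃ i j, v = node (leaf i) (leaf j)

/-- The leaf reached from the root by going down left edges. -/
def flag : LTree → ℕ
  | leaf i => i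
  | node l _ => l.flag

/-- Deletion of the left edges of all right children. The flag `isRight` says whether the root
of the given tree is a right child. The result consists of what remains at the place of this root,
and of the trees that are split off.

If an internal node is a right child, it is deleted, its right child takes its place, and its left
child becomes the root of a new tree. Otherwise the node stays. -/
def cut : (isRight : Bool) → LTree → LTree × List LTree
  | _, leaf i => (leaf i, [])
  | false, node l r =>
      (node (cut false l).1 (cut true r).1, (cut false l).2 ++ (cut true r).2)
  | true, node l r =>
      ((cut true r).1, (cut false l).1 :: ((cut false l).2 ++ (cut true r).2))

end LTree

/-- Label the leaves of a plane tree from left to right by `a, a + 1, a + 2, …`. -/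
def label : PlaneTree → ℕ → LTree
  | .nil, a => .leaf a
  | .node _ l r, a => .node (label l a) (label r (a + l.numLeaves))

/-- In a plane tree whose leaves are labelled by `a, a + 1, …`, delete the terminal node whose left
leaf is `i` (the node becomes a leaf). Nothing happens if there is no such node. -/
def trimTree : PlaneTree → ℕ → ℕ → PlaneTree
  | .nil, _, _ => .nil
  | .node _ l r, a, i =>
      if l = .nil ∧ r = .nil ∧ i = a then .nil
      else .node () (trimTree l a i) (trimTree r (a + l.numLeaves) i)

theorem trimTree_nil (a i : ℕ) : trimTree .nil a i = .nil := rfl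

/-- An indexed forest: a sequence of plane binary trees, all but finitely many trivial. -/
@[ext]
structure IndexedForest : Type where
  tree : ℕ → PlaneTree
  finite : {k | tree k ≠ .nil}.Finite

namespace IndexedForest

/-- The empty forest: all trees are trivial. -/
def empty : IndexedForest where
  tree _ := .nil
  finite := by simp

/-- The first leaf of the `k`-th tree, when all leaves of the forest are numbered from left to
right. -/
def start (F : IndexedForest) (k : ℕ) : ℕ := ∑ j ∈ Finset.range k, (F.tree j).numLeaves

/-- The `k`-th tree of the forest, with its leaves labelled by their numbers in the forest. -/
def labelled (F : IndexedForest) (k : ℕ) : LTree := label (F.tree k) (F.start k)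

/-- The support: the set of leaves of the nontrivial trees. -/
def supp (F : IndexedForest) : Set ℕ :=
  {m | ∃ k, F.tree k ≠ .nil ∧ m ∈ (F.labelled k).leaves}

/-- The set `QDes(F)` of the left leaves of the terminal nodes. -/
def qdes (F : IndexedForest) : Set ℕ :=
  {i | ∃ k, ∃ v ∈ (F.labelled k).internal, v.IsTerminal ∧ v.flag = i}

/-- The trimmed forest `F/i`, for `i ∈ QDes(F)`: delete the terminal node `v` with left leaf
`i`. -/
def trim (F : IndexedForest) (i : ℕ) : IndexedForest where
  tree k := trimTree (F.tree k) (F.start k) i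
  finite := F.finite.subset fun k hk h => hk (by
    show trimTree (F.tree k) (F.start k) i = .nil
    rw [h]
    exact trimTree_nil _ _)

/-- The family of leaf-labelled trees of the nested forest `LC(F)`, obtained from `F` by deleting
the left edge of each right child. -/
def LC (F : IndexedForest) : Set LTree :=
  {T | ∃ k, T = ((F.labelled k).cut false).1 ∨ T ∈ ((F.labelled k).cut false).2}

end IndexedForest

/-- The forests supported on `[n]`. -/
def Forest (n : ℕ) : Set IndexedForest := {F | F.supp ⊆ ↑(Finset.range n)}

/-! ### Noncrossing permutations -/

/-- A partition of `[n]` is noncrossing if there are no `a < c < b < d` with `a, b` in one block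
and `c, d` in another. -/
def IsNoncrossing {n : ℕ} (P : Finpartition (Finset.range n)) : Prop :=
  ∀ B ∈ P.parts, ∀ C ∈ P.parts, B ≠ C →
    ∀ a ∈ B, ∀ b ∈ B, ∀ c ∈ C, ∀ d ∈ C, ¬ (a < c ∧ c < b ∧ b < d)

/-- The backward cycle `(a_p a_{p-1} … a_1)` of a set `{a_p > a_{p-1} > … > a_1}`, which maps
`a_p ↦ a_{p-1} ↦ … ↦ a_1 ↦ a_p`. -/
def backCycle (B : Finset ℕ) : Equiv.Perm ℕ := (B.sort (· ≥ ·)).formPerm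

/-- The product of the backward cycles of a finite family of blocks. The blocks will be pairwise
disjoint, so that these cycles commute and the order of the product does not matter. -/
def permOfBlocks (P : Finset (Finset ℕ)) : Equiv.Perm ℕ := (P.toList.map backCycle).prod

/-- The set `NC_n` of noncrossing permutations of `[n]`. -/
def NC (n : ℕ) : Set (Equiv.Perm ℕ) :=
  {σ | ∃ P : Finpartition (Finset.range n), IsNoncrossing P ∧ σ = permOfBlocks P.parts}

open Classical in
/-- The permutation of `[n]` whose cycles are the leaf sets, as far as they are contained in `[n]`,
of the trees of a nested forest. -/
def NCPerm (n : ℕ) (S : Set LTree) : Equiv.Perm ℕ :=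
  permOfBlocks {B ∈ (Finset.range n).powerset | ∃ T ∈ S, T.leaves.toFinset = B}

/-- The map `ForToNC` from `Forest n` to `NC n`. -/
def ForToNC (n : ℕ) (F : IndexedForest) : Equiv.Perm ℕ := NCPerm n F.LC

open Classical in
/-- The noncrossing inversion set of a noncrossing permutation of `[n]`. -/
def invNC (n : ℕ) (σ : Equiv.Perm ℕ) : Finset (ℕ × ℕ) :=
  {p ∈ Finset.range n ×ˢ Finset.range n |
    p.1 < p.2 ∧ σ * Equiv.swap p.1 p.2 ∈ NC n ∧ σ p.1 > σ p.2}

/-! ### Double forest polynomials -/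

/-- The ring `ℤ[t][x]`, as the polynomial ring in both sets of variables. -/
abbrev PolyTX : Type := MvPolynomial (ℕ ⊕ ℕ) ℤ

/-- The ring `ℤ[t]`. -/
abbrev PolyT : Type := MvPolynomial ℕ ℤ

/-- The non-equivariant variable `x_i`. -/
def x (i : ℕ) : PolyTX := MvPolynomial.X (Sum.inl i)

/-- The equivariant variable `t_i`. -/
def t (i : ℕ) : PolyTX := MvPolynomial.X (Sum.inr i)

/-- The evaluation `ev_σ f = f(t_{σ(1)}, t_{σ(2)}, …; t)`. -/
def ev (σ : Equiv.Perm ℕ) : PolyTX →ₐ[ℤ] PolyT :=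
  MvPolynomial.aeval (Sum.elim (fun i => MvPolynomial.X (σ i)) MvPolynomial.X)

/-- The Bergeron–Sottile map `f ↦ f(x_1, …, x_{i-1}, t_i, x_i, x_{i+1}, …; t)`. -/
def ropeMinus (i : ℕ) : PolyTX →ₐ[ℤ] PolyTX :=
  MvPolynomial.aeval
    (Sum.elim (fun j => if j < i then x j else if j = i then t i else x (j - 1)) t)

/-- The Bergeron–Sottile map `f ↦ f(x_1, …, x_{i-1}, x_i, t_i, x_{i+1}, …; t)`. -/
def ropePlus (i : ℕ) : PolyTX →ₐ[ℤ] PolyTX :=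
  MvPolynomial.aeval
    (Sum.elim (fun j => if j < i + 1 then x j else if j = i + 1 then t i else x (j - 1)) t)

theorem dvd_rope_sub (i : ℕ) (f : PolyTX) : x i - t i ∣ ropePlus i f - ropeMinus i f := by
  rw [← Ideal.mem_span_singleton, ← Ideal.Quotient.mk_eq_mk_iff_sub_mem]
  have hxt : Ideal.Quotient.mk (Ideal.span {x i - t i}) (x i) =
      Ideal.Quotient.mk (Ideal.span {x i - t i}) (t i) := by
    rw [Ideal.Quotient.mk_eq_mk_iff_sub_mem]
    exact Ideal.mem_span_singleton_self _
  have h : ((Ideal.Quotient.mkₐ ℤ (Ideal.span {x i - t i})).comp (ropePlus i)) =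
      ((Ideal.Quotient.mkₐ ℤ (Ideal.span {x i - t i})).comp (ropeMinus i)) := by
    apply MvPolynomial.algHom_ext
    rintro (j | j)
    · rcases lt_trichotomy j i with hj | rfl | hj
      · simp [ropePlus, ropeMinus, hj, hj.le]
      · simpa [ropePlus, ropeMinus] using hxt
      · have h1 : ¬ j ≤ i := by omega
        have h2 : ¬ j < i := by omega
        have h3 : j ≠ i := by omega
        by_cases h4 : j = i + 1
        · subst h4
          simpa [ropePlus, ropeMinus] using hxt.symm
        · simp [ropePlus, ropeMinus, h1, h2, h3, h4]
    · simp [ropePlus, ropeMinus]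
  exact DFunLike.congr_fun h f

/-- The equivariant trimming operation `E_i f`, the quotient of `R_i^+ f - R_i^- f` by
`x_i - t_i`. -/
def eope (i : ℕ) (f : PolyTX) : PolyTX := (dvd_rope_sub i f).choose

theorem eope_spec (i : ℕ) (f : PolyTX) :
    ropePlus i f - ropeMinus i f = (x i - t i) * eope i f :=
  (dvd_rope_sub i f).choose_spec

/-- The substitution `f(x; t) ↦ f(x; t_1, …, t_{i-1}, t_{i+1}, …)`. -/
def omitT (i : ℕ) : PolyTX →ₐ[ℤ] PolyTX :=
  MvPolynomial.aeval (Sum.elim x (fun j => if j < i then t j else t (j + 1)))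

/-- The characterization of the family of double forest polynomials: each member is homogeneous
(jointly in `x` and `t`), with the normalization `𝔓_F(t; t) = δ_{F,∅}`, and `E_i 𝔓_F` is
`𝔓_{F/i}(x; t_1, …, t_{i-1}, t_{i+1}, …)` if `i ∈ QDes(F)` and zero otherwise. -/
structure IsDoubleForestFamily (P : IndexedForest → PolyTX) : Prop where
  homogeneous : ∀ F, ∃ d, (P F).IsHomogeneous d
  ev_one_empty : ev 1 (P IndexedForest.empty) = 1
  ev_one : ∀ F, F ≠ IndexedForest.empty → ev 1 (P F) = 0
  eope_mem : ∀ F i, i ∈ F.qdes → eope i (P F) = omitT i (P (F.trim i))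
  eope_notMem : ∀ F i, i ∉ F.qdes → eope i (P F) = 0

open Classical in
/-- The double forest polynomials: the unique family with the above properties. (If there were no
such family, or more than one, the value would be `0`, and so would be all its evaluations.) -/
def doubleForest : IndexedForest → PolyTX :=
  if h : ∃! P : IndexedForest → PolyTX, IsDoubleForestFamily P then h.choose else 0

end

end DoubleForest

/-! The proof is an induction that removes one terminal node of the forest and, simultaneously, one
point of the permutation.

On the polynomial side, let `w` be a permutation, insert a fixed point `i` to get `insertFixed i w`,
and compare this with its product by the transposition of `i` and `i + 1`. The evaluations at these
two permutations substitute `t i` for `x i` and for `x (i + 1)`, so they differ by `(t_{skip i (w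
i)} - t_i)` times an evaluation of `E_i f` (`ev_sub_ev`). If one of them vanishes, the other is
`t_{σ(i)} - t_{σ(i+1)}` times the evaluation of `E_i f` at `w` (`ev_eq_of_ev_eq_zero`). For `f =
𝔓_F` and `i ∈ QDes(F)` the latter is the evaluation of `𝔓_{F/i}` at `w`, with the variables
relabelled to avoid `t i`.

The vanishing comes from Bruhat order, in the form of rank inequalities: if `σ` is noncrossing and
`ev_σ 𝔓_F ≠ 0`, then the permutation of `F` lies below `σ` (`rk_perm_le`). Every noncrossing `σ ≠ 1`
has a position `i` of the above kind (`IsNC.exists_isTrimmable`), and the inequality passes from `w`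
to `σ` by the lifting property (`rk_le_of_descent`). At `i ∈ QDes(F)` the permutation of `F` has a
descent, so exchanging its values at `i` and `i + 1` gives something strictly smaller in Bruhat
order, where `𝔓_F` vanishes.

On the combinatorial side, the permutation of `F` arises from that of `F/i` in one of these two ways
(`perm_trim`), and its noncrossing inversions are `(i, i + 1)` and the relabelled inversions of the
smaller permutation (`isInv_insertFixed`, `isInv_insertFixed_mul_swap`). So both sides of the
formula obey the same recursion.

Two foundations are needed: the double forest polynomials exist and are unique, which means solving
the system `E_i f = g_i` (`eope_solve`), and `ForToNC` agrees with the recursively defined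
permutation (`forToNC_eq_perm`). -/

namespace DoubleForest
open MvPolynomial

/-! ### Inserting an equivariant variable -/

/-- Insert `t s` as the value of `x i`, shifting the later `x`-variables. -/
noncomputable def insertT (i s : ℕ) : PolyTX →ₐ[ℤ] PolyTX :=
  aeval (Sum.elim (fun j => if j < i then x j else if j = i then t s else x (j - 1)) t)

@[simp] theorem insertT_t (i s j : ℕ) : insertT i s (t j) = t j := by simp [insertT, t]

theorem insertT_x (i s j : ℕ) :
    insertT i s (x j) = if j < i then x j else if j = i then t s else x (j - 1) := by
  simp [insertT, x]

theorem polyTX_hom_ext {A : Type*} [CommSemiring A] [Algebra ℤ A] {φ ψ : PolyTX →ₐ[ℤ] A}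
    (hx : ∀ j, φ (x j) = ψ (x j)) (ht : ∀ j, φ (t j) = ψ (t j)) : φ = ψ := by
  apply algHom_ext
  rintro (j | j)
  · exact hx j
  · exact ht j

theorem x_sub_t_ne_zero (i j : ℕ) : x i - t j ≠ 0 := by
  rw [sub_ne_zero]
  exact fun h => by simpa using X_injective h

/-- The numerator of the trimming operator at position `i` that uses `t s`. -/
noncomputable def trimDiff (i s : ℕ) (f : PolyTX) : PolyTX := insertT (i + 1) s f - insertT i s f

theorem trimDiff_self (i : ℕ) (f : PolyTX) : trimDiff i i f = (x i - t i) * eope i f :=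
  eope_spec i f

theorem trimDiff_sub (i s : ℕ) (f g : PolyTX) :
    trimDiff i s (f - g) = trimDiff i s f - trimDiff i s g := by
  simp only [trimDiff, map_sub]; ring

theorem trimDiff_add (i s : ℕ) (f g : PolyTX) :
    trimDiff i s (f + g) = trimDiff i s f + trimDiff i s g := by
  simp only [trimDiff, map_add]; ring

/-- Since `eope` is a chosen quotient, it is computed through this cancellation in a domain. -/
theorem eope_eq_of_trimDiff {i : ℕ} {f g : PolyTX} (h : trimDiff i i f = (x i - t i) * g) :
    eope i f = g :=
  mul_left_cancel₀ (x_sub_t_ne_zero i i) ((trimDiff_self i f).symm.trans h)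

theorem eope_sub (i : ℕ) (f g : PolyTX) : eope i (f - g) = eope i f - eope i g :=
  eope_eq_of_trimDiff (by rw [trimDiff_sub, trimDiff_self, trimDiff_self]; ring)

theorem eope_add (i : ℕ) (f g : PolyTX) : eope i (f + g) = eope i f + eope i g :=
  eope_eq_of_trimDiff (by rw [trimDiff_add, trimDiff_self, trimDiff_self]; ring)

theorem eope_zero (i : ℕ) : eope i 0 = 0 :=
  eope_eq_of_trimDiff (by simp [trimDiff])

/-- Filling the slot `x k` moves the later variables down by one, so the slot `i + 1` of `f` becomes
the slot `i`. -/
theorem insertT_comm {i k : ℕ} (h : k ≤ i) (r s : ℕ) (f : PolyTX) :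
    insertT i s (insertT k r f) = insertT k r (insertT (i + 1) s f) := by
  suffices H : (insertT i s).comp (insertT k r) = (insertT k r).comp (insertT (i + 1) s) by
    rw [← AlgHom.comp_apply, H, AlgHom.comp_apply]
  refine polyTX_hom_ext (fun j => ?_) (fun j => by simp)
  simp only [AlgHom.comp_apply, insertT_x]
  rcases lt_trichotomy j k with h1 | rfl | h1
  · simp [insertT_x, h1, show j < i by omega, show j < i + 1 by omega]
  · simp [insertT_x, show j < i + 1 by omega]
  · rcases lt_trichotomy j (i + 1) with h2 | rfl | h2
    · simp [insertT_x, show ¬ j < k by omega, show ¬ j = k by omega, h2, show j - 1 < i by omega]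
    · simp [show ¬ i + 1 < k by omega, show ¬ i + 1 = k by omega, insertT_x]
    · simp [insertT_x, show ¬ j < k by omega, show ¬ j = k by omega, show ¬ j < i + 1 by omega,
        show ¬ j = i + 1 by omega, show ¬ j - 1 < i by omega, show ¬ j - 1 = i by omega,
        show ¬ j - 1 < k by omega, show ¬ j - 1 = k by omega]

theorem trimDiff_comm {i k : ℕ} (h : k < i) (r s : ℕ) (f : PolyTX) :
    trimDiff i s (trimDiff k r f) = trimDiff k r (trimDiff (i + 1) s f) := by
  simp only [trimDiff, map_sub]
  rw [insertT_comm (i := i + 1) (k := k + 1) (by omega),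
    insertT_comm (i := i + 1) (k := k) (by omega),
    insertT_comm (i := i) (k := k + 1) (by omega), insertT_comm (i := i) (k := k) (by omega)]
  ring

/-- This is `trimDiff_comm` divided by `x k - t k`, a factor that insertion at the larger positions
`i` and `i + 1` does not touch. The left side has `t (i + 1)` at position `i` because `E_k` shifts
positions but does not rename equivariant variables. -/
theorem trimDiff_eope {i k : ℕ} (h : k < i) (f : PolyTX) :
    trimDiff i (i + 1) (eope k f) = (x i - t (i + 1)) * eope k (eope (i + 1) f) := by
  apply mul_left_cancel₀ (x_sub_t_ne_zero k k)
  have h1 : (x k - t k) * trimDiff i (i + 1) (eope k f)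
      = trimDiff i (i + 1) ((x k - t k) * eope k f) := by
    have h2 : k < i + 1 := by omega
    simp only [trimDiff, map_sub, map_mul, insertT_x, insertT_t, if_pos h, if_pos h2]
    ring
  have h2 : trimDiff k k ((x (i + 1) - t (i + 1)) * eope (i + 1) f)
      = (x i - t (i + 1)) * trimDiff k k (eope (i + 1) f) := by
    have h2 : ¬ i + 1 < k := by omega
    have h3 : ¬ i + 1 = k := by omega
    have h4 : ¬ i + 1 < k + 1 := by omega
    have h5 : ¬ i + 1 = k + 1 := by omega
    simp only [trimDiff, map_sub, map_mul, insertT_x, insertT_t, if_neg h2, if_neg h3, if_neg h4,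
      if_neg h5, Nat.add_sub_cancel]
    ring
  rw [h1, ← trimDiff_self, trimDiff_comm h, trimDiff_self (i + 1), h2, trimDiff_self]
  ring

/-! ### Polynomials in finitely many of the `x`-variables -/

/-- The polynomials that involve `x j` only for `j < k`. -/
noncomputable def xBelow (k : ℕ) : Subalgebra ℤ PolyTX :=
  supported ℤ {v | ∀ j, v = Sum.inl j → j < k}

theorem x_mem_xBelow {j k : ℕ} (h : j < k) : x j ∈ xBelow k := by
  simp [xBelow, x, X_mem_supported, h]

theorem t_mem_xBelow (j k : ℕ) : t j ∈ xBelow k := by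
  simp [xBelow, t, X_mem_supported]

theorem xBelow_mono {k m : ℕ} (h : k ≤ m) : xBelow k ≤ xBelow m :=
  supported_mono fun _ hv j hj => (hv j hj).trans_le h

theorem exists_mem_xBelow (f : PolyTX) : ∃ k, f ∈ xBelow k := by
  induction f using MvPolynomial.induction_on with
  | C a => exact ⟨0, (xBelow 0).algebraMap_mem a⟩
  | add p q hp hq =>
    obtain ⟨k, hk⟩ := hp
    obtain ⟨m, hm⟩ := hq
    exact ⟨max k m, add_mem (xBelow_mono (le_max_left _ _) hk) (xBelow_mono (le_max_right _ _) hm)⟩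
  | mul_X p v hp =>
    obtain ⟨k, hk⟩ := hp
    rcases v with j | j
    · exact ⟨max k (j + 1), mul_mem (xBelow_mono (le_max_left _ _) hk)
        (x_mem_xBelow (lt_max_of_lt_right (Nat.lt_succ_self j)))⟩
    · exact ⟨k, mul_mem hk (t_mem_xBelow j k)⟩

theorem xBelow_hom_congr {A : Type*} [CommSemiring A] [Algebra ℤ A] {φ ψ : PolyTX →ₐ[ℤ] A} {k : ℕ}
    (hx : ∀ j < k, φ (x j) = ψ (x j)) (ht : ∀ j, φ (t j) = ψ (t j)) {f : PolyTX}
    (hf : f ∈ xBelow k) : φ f = ψ f := by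
  have hle : xBelow k ≤ AlgHom.equalizer φ ψ := by
    refine Algebra.adjoin_le ?_
    rintro _ ⟨v, hv, rfl⟩
    rcases v with j | j
    · exact hx j (hv j rfl)
    · exact ht j
  exact hle hf

theorem insertT_of_mem_xBelow {i s : ℕ} {f : PolyTX} (hf : f ∈ xBelow i) : insertT i s f = f :=
  xBelow_hom_congr (φ := insertT i s) (ψ := AlgHom.id ℤ PolyTX)
    (fun j hj => by simp [insertT_x, hj]) (fun j => by simp) hf

theorem insertT_mem_xBelow {k s : ℕ} {f : PolyTX} (hf : f ∈ xBelow (k + 1)) :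
    insertT k s f ∈ xBelow k := by
  have hle : xBelow (k + 1) ≤ (xBelow k).comap (insertT k s) := by
    refine Algebra.adjoin_le ?_
    rintro _ ⟨v, hv, rfl⟩
    rcases v with j | j
    · have hj : j < k + 1 := hv j rfl
      change insertT k s (x j) ∈ xBelow k
      rw [insertT_x]
      split_ifs with h1 h2
      · exact x_mem_xBelow h1
      · exact t_mem_xBelow _ _
      · omega
    · change insertT k s (t j) ∈ xBelow k
      rw [insertT_t]
      exact t_mem_xBelow _ _
  exact hle hf

/-- The variables are removed from the top: if `x m` is the last one that may occur, insertion at `m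
+ 1` fixes `f`, so `f` equals its insertion at `m`, which is free of `x m`. -/
theorem mem_xBelow_of_trimDiff_eq_zero {k : ℕ} (s : ℕ → ℕ) {f : PolyTX}
    (h : ∀ i, k ≤ i → trimDiff i (s i) f = 0) : f ∈ xBelow k := by
  obtain ⟨m, hm⟩ := exists_mem_xBelow f
  induction m with
  | zero => exact xBelow_mono (Nat.zero_le k) hm
  | succ m ih =>
    rcases Nat.lt_or_ge m k with hk | hk
    · exact xBelow_mono hk hm
    · apply ih
      have h1 := h m hk
      rw [trimDiff, insertT_of_mem_xBelow hm, sub_eq_zero] at h1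
      rw [h1]
      exact insertT_mem_xBelow hm

theorem eope_of_mem_xBelow {i : ℕ} {f : PolyTX} (hf : f ∈ xBelow i) : eope i f = 0 :=
  eope_eq_of_trimDiff (by
    rw [trimDiff, insertT_of_mem_xBelow hf, insertT_of_mem_xBelow (xBelow_mono i.le_succ hf)]
    ring)

/-- Insertion at `i + 1` changes nothing, and insertion at `i` sends `x i - t i` to zero. -/
theorem eope_mul_of_mem_xBelow {i : ℕ} {f : PolyTX} (hf : f ∈ xBelow (i + 1)) :
    eope i ((x i - t i) * f) = f :=
  eope_eq_of_trimDiff (by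
    have h1 : (x i - t i) * f ∈ xBelow (i + 1) :=
      mul_mem (sub_mem (x_mem_xBelow i.lt_succ_self) (t_mem_xBelow _ _)) hf
    rw [trimDiff, insertT_of_mem_xBelow h1]
    simp [insertT_x])

theorem ev_x (σ : Equiv.Perm ℕ) (j : ℕ) : ev σ (x j) = X (σ j) := by simp [ev, x]

theorem ev_t (σ : Equiv.Perm ℕ) (j : ℕ) : ev σ (t j) = X j := by simp [ev, t]

/-- Such an `f` contains no `x`-variable, so setting `x = t` loses no information. This gives
uniqueness of the family. -/
theorem eq_zero_of_eope_eq_zero {f : PolyTX} (h : ∀ i, eope i f = 0) (h1 : ev 1 f = 0) :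
    f = 0 := by
  have hf : f ∈ xBelow 0 := mem_xBelow_of_trimDiff_eq_zero id fun i _ => by
    rw [id, trimDiff_self, h, mul_zero]
  have h2 := xBelow_hom_congr (φ := (rename Sum.inr).comp (ev 1)) (ψ := AlgHom.id ℤ PolyTX)
    (fun j hj => absurd hj j.not_lt_zero) (fun j => by simp [ev_t]; rfl) hf
  simpa [h1] using h2.symm

/-! ### Homogeneity -/

theorem isHomogeneous_x_sub_t (i j : ℕ) : (x i - t j).IsHomogeneous 1 :=
  (isHomogeneous_X _ _).sub (isHomogeneous_X _ _)

theorem isHomogeneous_insertT {f : PolyTX} {d : ℕ} (hf : f.IsHomogeneous d) (i s : ℕ) :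
    (insertT i s f).IsHomogeneous d := by
  have := hf.aeval (Sum.elim (fun j => if j < i then x j else if j = i then t s else x (j - 1)) t)
    (n := 1) (by
      rintro (j | j)
      · simp only [Sum.elim_inl]
        split_ifs <;> exact isHomogeneous_X _ _
      · exact isHomogeneous_X _ _)
  simpa [insertT] using this

theorem isHomogeneous_omitT {f : PolyTX} {d : ℕ} (hf : f.IsHomogeneous d) (i : ℕ) :
    (omitT i f).IsHomogeneous d := by
  have := hf.aeval (Sum.elim x (fun j => if j < i then t j else t (j + 1)))
    (n := 1) (by
      rintro (j | j)
      · exact isHomogeneous_X _ _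
      · simp only [Sum.elim_inr]
        split_ifs <;> exact isHomogeneous_X _ _)
  simpa [omitT] using this

/-- The degree `k + 1` component of `p * f` is `p` times the degree `k` component of `f`, and `p` is
not a zero divisor. -/
theorem isHomogeneous_of_mul {σ : Type*} {p f : MvPolynomial σ ℤ} {d : ℕ} (hp : p.IsHomogeneous 1)
    (hp0 : p ≠ 0) (h : (p * f).IsHomogeneous (d + 1)) : f.IsHomogeneous d := by
  let _ : GradedAlgebra (homogeneousSubmodule σ ℤ) := gradedAlgebra
  have key : ∀ k, k ≠ d → homogeneousComponent k f = 0 := by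
    intro k hk
    have h1 := DirectSum.coe_decompose_mul_add_of_left_mem (homogeneousSubmodule σ ℤ)
      (i := 1) (j := k) (b := f) (show p ∈ homogeneousSubmodule σ ℤ 1 from hp)
    have h2 : (DirectSum.decompose (homogeneousSubmodule σ ℤ) (p * f) (1 + k) : MvPolynomial σ ℤ)
        = 0 := by
      rw [DirectSum.decompose_of_mem_ne _ (show p * f ∈ homogeneousSubmodule σ ℤ (d + 1) from h)]
      omega
    rw [h2] at h1
    rw [← decomposition.decompose'_apply]
    exact (mul_eq_zero.mp h1.symm).resolve_left hp0
  have h3 := sum_homogeneousComponent f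
  rw [← h3]
  refine IsHomogeneous.sum _ _ _ fun k _ => ?_
  by_cases hk : k = d
  · rw [hk]; exact homogeneousComponent_isHomogeneous d f
  · rw [key k hk]; exact isHomogeneous_zero _ _ _

theorem isHomogeneous_eope {f : PolyTX} {d : ℕ} (hf : f.IsHomogeneous (d + 1)) (i : ℕ) :
    (eope i f).IsHomogeneous d := by
  refine isHomogeneous_of_mul (isHomogeneous_x_sub_t i i) (x_sub_t_ne_zero i i) ?_
  rw [← trimDiff_self]
  exact (isHomogeneous_insertT hf _ _).sub (isHomogeneous_insertT hf _ _)

/-! ### Solving `E_i f = g_i` -/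

/-- A polynomial with prescribed images under the operators `E_i` for `i ≥ N - k`, provided that
these are compatible and vanish for `i ≥ N`. -/
noncomputable def solve (g : ℕ → PolyTX) (N : ℕ) : ℕ → PolyTX
  | 0 => 0
  | k + 1 => solve g N k + (x (N - (k + 1)) - t (N - (k + 1))) *
      (g (N - (k + 1)) - eope (N - (k + 1)) (solve g N k))

theorem ev_one_solve (g : ℕ → PolyTX) (N k : ℕ) : ev 1 (solve g N k) = 0 := by
  induction k with
  | zero => simp [solve]
  | succ k ih => simp [solve, ih, ev_x, ev_t]

theorem isHomogeneous_solve {g : ℕ → PolyTX} {d : ℕ} (hg : ∀ i, (g i).IsHomogeneous d) (N k : ℕ) :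
    (solve g N k).IsHomogeneous (d + 1) := by
  induction k with
  | zero => exact isHomogeneous_zero _ _ _
  | succ k ih =>
    refine ih.add ?_
    rw [add_comm d 1]
    exact (isHomogeneous_x_sub_t _ _).mul ((hg _).sub (isHomogeneous_eope ih _))

theorem eope_solve {g : ℕ → PolyTX} {N : ℕ} (hN : ∀ i, N ≤ i → g i = 0)
    (hg : ∀ k i, k < i → trimDiff i (i + 1) (g k) = (x i - t (i + 1)) * eope k (g (i + 1)))
    {k : ℕ} (hk : k ≤ N) : ∀ i, N - k ≤ i → eope i (solve g N k) = g i := by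
  induction k with
  | zero =>
    intro i hi
    rw [hN i (by omega), solve, eope_zero]
  | succ k ih =>
    have ih := ih (by omega)
    obtain ⟨m, hm⟩ : ∃ m, m = N - (k + 1) := ⟨_, rfl⟩
    have hmk : N - k = m + 1 := by omega
    rw [hmk] at ih
    intro i hi
    rw [← hm] at hi
    rw [solve, ← hm]
    -- The compatibility condition makes the correction free of `x i` for `i > m`. So adding `x m -
    -- t m` times it repairs the equation for `E_m` without disturbing those for larger indices.
    have hu : g m - eope m (solve g N k) ∈ xBelow (m + 1) :=
      mem_xBelow_of_trimDiff_eq_zero (fun i => i + 1) fun i hi => by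
        rw [trimDiff_sub, hg m i hi, trimDiff_eope hi, ih (i + 1) (by omega), sub_self]
    rw [eope_add]
    rcases hi.eq_or_lt with rfl | hi
    · rw [eope_mul_of_mem_xBelow hu]; ring
    · rw [ih i hi, eope_of_mem_xBelow, add_zero]
      exact xBelow_mono hi (mul_mem (sub_mem (x_mem_xBelow m.lt_succ_self) (t_mem_xBelow _ _)) hu)

/-! ### Omitting an equivariant variable -/

/-- The increasing bijection from `ℕ` onto the complement of `i`. -/
def skip (i j : ℕ) : ℕ := if j < i then j else j + 1

theorem omitT_x (i j : ℕ) : omitT i (x j) = x j := by simp [omitT, x]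

theorem omitT_t (i j : ℕ) : omitT i (t j) = t (skip i j) := by
  simp only [omitT, t, skip, aeval_X, Sum.elim_inr]; split_ifs <;> rfl

theorem insertT_omitT (i s k : ℕ) (f : PolyTX) :
    insertT i (skip k s) (omitT k f) = omitT k (insertT i s f) := by
  suffices H : (insertT i (skip k s)).comp (omitT k) = (omitT k).comp (insertT i s) by
    rw [← AlgHom.comp_apply, H, AlgHom.comp_apply]
  refine polyTX_hom_ext (fun j => ?_) (fun j => by simp [omitT_t])
  simp only [AlgHom.comp_apply, insertT_x, omitT_x]
  split_ifs <;> simp only [omitT_x, omitT_t]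

theorem trimDiff_omitT (i s k : ℕ) (f : PolyTX) :
    trimDiff i (skip k s) (omitT k f) = omitT k (trimDiff i s f) := by
  simp only [trimDiff, insertT_omitT, map_sub]

theorem eope_omitT {i k : ℕ} (h : i < k) (f : PolyTX) :
    eope i (omitT k f) = omitT k (eope i f) := by
  apply eope_eq_of_trimDiff
  have h1 : skip k i = i := if_pos h
  have h2 := trimDiff_omitT i i k f
  rwa [h1, trimDiff_self i f, map_mul, map_sub, omitT_x, omitT_t, h1] at h2

/-- Omitting `t k` with `k ≤ i` renames `t i` to `t (i + 1)`; hence the shifted index in the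
compatibility condition of `eope_solve`. -/
theorem trimDiff_succ_omitT {i k : ℕ} (h : k ≤ i) (f : PolyTX) :
    trimDiff i (i + 1) (omitT k f) = (x i - t (i + 1)) * omitT k (eope i f) := by
  have h1 : skip k i = i + 1 := if_neg (by omega)
  have h2 := trimDiff_omitT i i k f
  rw [h1, trimDiff_self, map_mul, map_sub, omitT_x, omitT_t, h1] at h2
  exact h2

theorem omitT_comm {i k : ℕ} (h : k ≤ i) (f : PolyTX) :
    omitT k (omitT i f) = omitT (i + 1) (omitT k f) := by
  suffices H : (omitT k).comp (omitT i) = (omitT (i + 1)).comp (omitT k) by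
    rw [← AlgHom.comp_apply, H, AlgHom.comp_apply]
  refine polyTX_hom_ext (fun j => by simp [omitT_x]) (fun j => ?_)
  simp only [AlgHom.comp_apply, omitT_t, skip]
  congr 1
  split_ifs <;> omega

end DoubleForest

namespace DoubleForest
open Equiv

/-! ### Permutations with a prescribed fixed point -/

theorem skip_lt_skip {i a b : ℕ} : skip i a < skip i b ↔ a < b := by
  unfold skip; split_ifs <;> omega

theorem skip_le_skip {i a b : ℕ} : skip i a ≤ skip i b ↔ a ≤ b := by
  unfold skip; split_ifs <;> omega

theorem skip_injective (i : ℕ) : Function.Injective (skip i) := fun a b h => by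
  unfold skip at h; split_ifs at h <;> omega

theorem skip_ne (i a : ℕ) : skip i a ≠ i := by
  unfold skip; split_ifs <;> omega

theorem skip_lt_skip_succ {i a b : ℕ} : skip i a < skip (i + 1) b ↔ a < b := by
  unfold skip; split_ifs <;> omega

theorem skip_succ_le_skip {i a b : ℕ} : skip (i + 1) a ≤ skip i b ↔ a ≤ b := by
  unfold skip; split_ifs <;> omega

theorem eq_or_exists_skip (i j : ℕ) : j = i ∨ ∃ k, j = skip i k := by
  rcases lt_trichotomy j i with h | h | h
  · exact Or.inr ⟨j, by simp [skip, h]⟩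
  · exact Or.inl h
  · exact Or.inr ⟨j - 1, by unfold skip; split_ifs <;> omega⟩

/-- `skip i` as a bijection onto the complement of `i`. -/
def skipEquiv (i : ℕ) : ℕ ≃ {j : ℕ // j ≠ i} where
  toFun j := ⟨skip i j, skip_ne i j⟩
  invFun j := if (j : ℕ) < i then j else j - 1
  left_inv j := by simp only [skip]; split_ifs <;> omega
  right_inv := by
    rintro ⟨j, hj⟩
    ext
    simp only [skip]
    split_ifs <;> omega

/-- The permutation that fixes `i` and acts as `w` on the complement of `i`, relabelled
increasingly. -/
def insertFixed (i : ℕ) (w : Perm ℕ) : Perm ℕ := w.extendDomain (skipEquiv i)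

@[simp] theorem insertFixed_self (i : ℕ) (w : Perm ℕ) : insertFixed i w i = i :=
  Perm.extendDomain_apply_not_subtype _ _ (by simp)

@[simp] theorem insertFixed_skip (i : ℕ) (w : Perm ℕ) (j : ℕ) :
    insertFixed i w (skip i j) = skip i (w j) :=
  Perm.extendDomain_apply_image w (skipEquiv i) j

theorem insertFixed_one (i : ℕ) : insertFixed i 1 = 1 := Perm.extendDomain_one _

theorem insertFixed_mul (i : ℕ) (v w : Perm ℕ) :
    insertFixed i (v * w) = insertFixed i v * insertFixed i w :=
  (Perm.extendDomain_mul _ _ _).symm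

theorem insertFixed_swap (i a b : ℕ) :
    insertFixed i (swap a b) = swap (skip i a) (skip i b) := by
  ext j
  rcases eq_or_exists_skip i j with rfl | ⟨k, rfl⟩
  · rw [insertFixed_self, swap_apply_of_ne_of_ne (skip_ne _ _).symm (skip_ne _ _).symm]
  · rw [insertFixed_skip, (skip_injective i).swap_apply]

theorem exists_eq_insertFixed {i : ℕ} {σ : Perm ℕ} (h : σ i = i) : ∃ w, σ = insertFixed i w := by
  have hne : ∀ j, σ j ≠ i ↔ j ≠ i := fun j => not_congr (σ.injective.eq_iff' h)
  refine ⟨(skipEquiv i).symm.permCongr (σ.subtypePerm (p := fun j => j ≠ i) hne), ?_⟩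
  ext j
  rcases eq_or_exists_skip i j with rfl | ⟨k, rfl⟩
  · rw [insertFixed_self, h]
  · rw [insertFixed_skip]
    exact (congrArg Subtype.val ((skipEquiv i).apply_symm_apply
      (σ.subtypePerm (p := fun j => j ≠ i) hne (skipEquiv i k)))).symm

theorem insertFixed_mul_swap_succ (i : ℕ) (w : Perm ℕ) :
    (insertFixed i w * swap i (i + 1)) (i + 1) = i := by simp

theorem insertFixed_mul_swap_skip (i : ℕ) (w : Perm ℕ) (j : ℕ) :
    (insertFixed i w * swap i (i + 1)) (skip (i + 1) j) = skip i (w j) := by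
  have h : swap i (i + 1) (skip (i + 1) j) = skip i j := by
    rcases lt_trichotomy j i with h | rfl | h
    · have h1 : skip (i + 1) j = j := if_pos (by omega)
      have h2 : skip i j = j := if_pos h
      rw [h1, h2, swap_apply_of_ne_of_ne] <;> omega
    · simp [skip]
    · have h1 : skip (i + 1) j = j + 1 := if_neg (by omega)
      have h2 : skip i j = j + 1 := if_neg (by omega)
      rw [h1, h2, swap_apply_of_ne_of_ne] <;> omega
  rw [Perm.mul_apply, h, insertFixed_skip]

/-! ### Noncrossing permutations in one-line form -/

/-- A permutation is noncrossing if, for each descending step `j ↦ σ j`, the interval strictly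
between is stable, and for each ascending step `j ↦ σ j`, the interval `[j, σ j]` is stable. -/
def IsNC (σ : Perm ℕ) : Prop :=
  (∀ j k, σ j < k → k < j → σ j < σ k ∧ σ k < j) ∧
    ∀ j k, j ≤ k → k ≤ σ j → j ≤ σ k ∧ σ k ≤ σ j

theorem isNC_one : IsNC 1 := by
  constructor <;> intro j k <;> simp only [Perm.one_apply] <;> omega

theorem isNC_insertFixed {i : ℕ} {w : Perm ℕ} : IsNC (insertFixed i w) ↔ IsNC w := by
  constructor
  · rintro ⟨h1, h2⟩
    constructor <;> intro j k
    · simpa only [insertFixed_skip, skip_lt_skip] using h1 (skip i j) (skip i k)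
    · simpa only [insertFixed_skip, skip_le_skip] using h2 (skip i j) (skip i k)
  · rintro ⟨h1, h2⟩
    constructor <;> intro j k
    · rcases eq_or_exists_skip i j with rfl | ⟨j, rfl⟩
      · rw [insertFixed_self]; omega
      · rcases eq_or_exists_skip i k with rfl | ⟨k, rfl⟩
        · rw [insertFixed_self]; omega
        · simpa only [insertFixed_skip, skip_lt_skip] using h1 j k
    · rcases eq_or_exists_skip i j with rfl | ⟨j, rfl⟩
      · rw [insertFixed_self]
        intro h3 h4
        obtain rfl := le_antisymm h3 h4
        simp
      · rcases eq_or_exists_skip i k with rfl | ⟨k, rfl⟩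
        · rw [insertFixed_self]; omega
        · simpa only [insertFixed_skip, skip_le_skip] using h2 j k

/-- Here positions are relabelled by `skip (i + 1)` and values by `skip i`. `IsNC` compares a value
with a position only in the forms value `<` position and position `≤` value, and the two
relabellings preserve exactly these. -/
theorem isNC_insertFixed_mul_swap {i : ℕ} {w : Perm ℕ} :
    IsNC (insertFixed i w * swap i (i + 1)) ↔ IsNC w := by
  constructor
  · rintro ⟨h1, h2⟩
    constructor <;> intro j k
    · intro h3 h4
      have := h1 (skip (i + 1) j) (skip (i + 1) k)
      simp only [insertFixed_mul_swap_skip, skip_lt_skip, skip_lt_skip_succ] at this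
      exact this h3 h4
    · intro h3 h4
      have := h2 (skip (i + 1) j) (skip (i + 1) k)
      simp only [insertFixed_mul_swap_skip, skip_le_skip, skip_succ_le_skip] at this
      exact this h3 h4
  · rintro ⟨h1, h2⟩
    constructor <;> intro j k
    · rcases eq_or_exists_skip (i + 1) j with rfl | ⟨j, rfl⟩
      · rw [insertFixed_mul_swap_succ]; omega
      · rcases eq_or_exists_skip (i + 1) k with rfl | ⟨k, rfl⟩
        · rw [insertFixed_mul_swap_succ, insertFixed_mul_swap_skip]
          have := skip_ne i (w j)
          omega
        · simpa only [insertFixed_mul_swap_skip, skip_lt_skip, skip_lt_skip_succ] using h1 j k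
    · rcases eq_or_exists_skip (i + 1) j with rfl | ⟨j, rfl⟩
      · rw [insertFixed_mul_swap_succ]; omega
      · rcases eq_or_exists_skip (i + 1) k with rfl | ⟨k, rfl⟩
        · rw [insertFixed_mul_swap_succ, insertFixed_mul_swap_skip]
          have := skip_ne (i + 1) j
          omega
        · simpa only [insertFixed_mul_swap_skip, skip_le_skip, skip_succ_le_skip] using h2 j k

/-- If `p < j`, the stable interval `[p, σ p] = [p, j]` would contain `σ j > j`. -/
theorem IsNC.lt_of_lt_apply {σ : Perm ℕ} (h : IsNC σ) {j p : ℕ} (hj : j < σ j) (hp : σ p = j) :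
    j < p := by
  rcases lt_trichotomy j p with h1 | rfl | h1
  · exact h1
  · omega
  · have := (h.2 p j h1.le hp.ge).2
    omega

/-- The adjacent descents of a permutation one of whose two values is the position `i`. -/
def IsTrimmable (σ : Perm ℕ) (i : ℕ) : Prop :=
  (σ (i + 1) = i ∧ i < σ i) ∨ (σ i = i ∧ σ (i + 1) < i)

theorem IsTrimmable.lt {σ : Perm ℕ} {i : ℕ} (h : IsTrimmable σ i) : σ (i + 1) < σ i := by
  rcases h with ⟨h1, h2⟩ | ⟨h1, h2⟩ <;> omega

theorem lt_apply_of_fixed_below {σ : Perm ℕ} {m : ℕ} (hm : σ m ≠ m)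
    (h : σ m < m → σ (σ m) = σ m) : m < σ m := by
  rcases lt_trichotomy (σ m) m with h1 | h1 | h1
  · exact absurd (σ.injective (h h1)) hm
  · exact absurd h1 hm
  · exact h1

/-- Among the cycles that move something, take one whose two smallest elements `j < k` are closest
together. If they are adjacent, `j` is a trimmable position. Otherwise every point strictly between
them is fixed, since a cycle nested there would have a smaller gap, and `k - 1` is trimmable. -/
theorem IsNC.exists_isTrimmable {σ : Perm ℕ} (h : IsNC σ) (h1 : σ ≠ 1) : ∃ i, IsTrimmable σ i := by
  classical
  -- An ascent `j < σ j` marks `j` as the least element of its cycle; then `σ.symm j` is the second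
  -- least, and `g` is the gap to be minimised.
  have hex : ∃ g j, j < σ j ∧ g = σ.symm j - j := by
    obtain ⟨m, hm, hmin⟩ : ∃ m, σ m ≠ m ∧ ∀ k < m, σ k = k := by
      have : ∃ m, σ m ≠ m := by
        by_contra! hc
        exact h1 (Equiv.ext hc)
      exact ⟨Nat.find this, Nat.find_spec this, fun k hk => not_not.mp (Nat.find_min this hk)⟩
    exact ⟨_, m, lt_apply_of_fixed_below hm fun h2 => hmin _ h2, rfl⟩
  obtain ⟨j, hj, hg⟩ := Nat.find_spec hex
  have hmin : ∀ m, m < σ m → σ.symm j - j ≤ σ.symm m - m := fun m hm => by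
    rw [← hg]
    exact Nat.find_min' hex ⟨m, hm, rfl⟩
  obtain ⟨k, hk⟩ : ∃ k, k = σ.symm j := ⟨_, rfl⟩
  rw [← hk] at hmin
  have hkj : σ k = j := by rw [hk, apply_symm_apply]
  have hjk : j < k := h.lt_of_lt_apply hj hkj
  by_cases hk1 : k = j + 1
  · exact ⟨j, Or.inl ⟨hk1 ▸ hkj, hj⟩⟩
  have hfix : ∀ m, j < m → m < k → σ m = m := by
    intro m
    induction m using Nat.strong_induction_on with
    | _ m ih =>
      intro hm1 hm2
      by_contra hc
      have hm3 : m < σ m := lt_apply_of_fixed_below hc fun h3 =>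
        ih _ h3 (by have := (h.1 k m (by omega) hm2).1; omega) (by omega)
      obtain ⟨p, hp⟩ : ∃ p, p = σ.symm m := ⟨_, rfl⟩
      have hpm : σ p = m := by rw [hp, apply_symm_apply]
      have hmp : m < p := h.lt_of_lt_apply hm3 hpm
      have hpk : p < k := by
        -- If `p > k`, then `k` lies in the stable interval strictly between `σ p = m` and `p`, but
        -- `σ k = j < m`.
        by_contra hpk
        have hne : p ≠ k := by rintro rfl; omega
        have := (h.1 p k (by omega) (by omega)).1
        omega
      have := hmin m hm3
      omega
  refine ⟨k - 1, Or.inr ⟨hfix _ (by omega) (by omega), ?_⟩⟩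
  rw [show k - 1 + 1 = k by omega]
  omega

/-- The two ways in which a permutation is built from a smaller one at a trimmable position. -/
theorem IsTrimmable.exists_insertFixed {σ : Perm ℕ} {i : ℕ} (h : IsTrimmable σ i) :
    ∃ w, σ = insertFixed i w ∨ σ = insertFixed i w * swap i (i + 1) := by
  rcases h with ⟨h1, h2⟩ | ⟨h1, h2⟩
  · obtain ⟨w, hw⟩ := exists_eq_insertFixed (i := i) (σ := σ * swap i (i + 1)) (by simp [h1])
    exact ⟨w, Or.inr (by rw [← hw, mul_assoc, swap_mul_self, mul_one])⟩
  · obtain ⟨w, hw⟩ := exists_eq_insertFixed h1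
    exact ⟨w, Or.inl hw⟩

/-! ### Rank functions -/

/-- The number of positions below `p` whose value is at least `q`. -/
def rk (σ : Perm ℕ) (p q : ℕ) : ℕ := ∑ j ∈ Finset.range p, if q ≤ σ j then 1 else 0

theorem rk_succ (σ : Perm ℕ) (p q : ℕ) :
    rk σ (p + 1) q = rk σ p q + if q ≤ σ p then 1 else 0 := Finset.sum_range_succ _ _

/-- Only the initial segment of length `i + 1` separates the positions `i` and `i + 1`. -/
theorem rk_mul_swap {σ : Perm ℕ} {i p : ℕ} (hp : p ≠ i + 1) (q : ℕ) :
    rk (σ * swap i (i + 1)) p q = rk σ p q := by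
  have hle : ∀ p ≤ i, rk (σ * swap i (i + 1)) p q = rk σ p q := by
    intro p hp
    refine Finset.sum_congr rfl fun j hj => ?_
    rw [Finset.mem_range] at hj
    rw [Perm.mul_apply, swap_apply_of_ne_of_ne] <;> omega
  rcases Nat.lt_or_ge p (i + 1) with h | h
  · exact hle p (by omega)
  obtain ⟨d, rfl⟩ : ∃ d, p = i + 2 + d := ⟨p - (i + 2), by omega⟩
  clear h hp
  induction d with
  | zero =>
    rw [add_zero, rk_succ, rk_succ, rk_succ, rk_succ, hle i le_rfl]
    simp only [Perm.mul_apply, swap_apply_left, swap_apply_right]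
    ring
  | succ d ih =>
    rw [← add_assoc, rk_succ, ih, rk_succ, Perm.mul_apply, swap_apply_of_ne_of_ne] <;> omega

theorem rk_insertFixed_of_le {i p : ℕ} (hp : p ≤ i) (w : Perm ℕ) (q : ℕ) :
    rk (insertFixed i w) p q = rk w p (if q ≤ i then q else q - 1) := by
  refine Finset.sum_congr rfl fun j hj => ?_
  rw [Finset.mem_range] at hj
  have h1 : skip i j = j := if_pos (by omega)
  have h2 := insertFixed_skip i w j
  rw [h1] at h2
  rw [h2]
  congr 1
  rw [eq_iff_iff]
  unfold skip
  split_ifs <;> omega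

theorem rk_insertFixed_of_lt {i p : ℕ} (hp : i ≤ p) (w : Perm ℕ) (q : ℕ) :
    rk (insertFixed i w) (p + 1) q =
      rk w p (if q ≤ i then q else q - 1) + if q ≤ i then 1 else 0 := by
  induction p, hp using Nat.le_induction with
  | base => rw [rk_succ, rk_insertFixed_of_le le_rfl, insertFixed_self]
  | succ p hp ih =>
    have h1 : skip i p = p + 1 := if_neg (by omega)
    have h2 := insertFixed_skip i w p
    rw [h1] at h2
    rw [rk_succ, ih, h2, rk_succ, add_right_comm]
    congr 2
    congr 1
    rw [eq_iff_iff]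
    unfold skip
    split_ifs <;> omega

theorem rk_insertFixed_mono {v w : Perm ℕ} (h : ∀ p q, rk v p q ≤ rk w p q) (i p q : ℕ) :
    rk (insertFixed i v) p q ≤ rk (insertFixed i w) p q := by
  rcases Nat.lt_or_ge i p with hp | hp
  · obtain ⟨p, rfl⟩ : ∃ r, p = r + 1 := ⟨p - 1, by omega⟩
    rw [rk_insertFixed_of_lt (by omega), rk_insertFixed_of_lt (by omega)]
    exact Nat.add_le_add_right (h _ _) _
  · rw [rk_insertFixed_of_le hp, rk_insertFixed_of_le hp]
    exact h _ _

/-- The lifting property of Bruhat order. Only `p = i + 1` is in question. If `q ≤ w' i`, the rank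
of `w'` there exceeds its rank at `i` by one, the most that `v'` can gain; if not, the descent makes
it equal to the rank of `w'` at `i + 2`. -/
theorem rk_le_of_descent {v w v' w' : Perm ℕ} {i : ℕ} (h : ∀ p q, rk v p q ≤ rk w p q)
    (hv : v' = v ∨ v' = v * swap i (i + 1)) (hw : w' = w ∨ w' = w * swap i (i + 1))
    (hd : w' (i + 1) < w' i) (p q : ℕ) : rk v' p q ≤ rk w' p q := by
  have hne : ∀ p, p ≠ i + 1 → rk v' p q ≤ rk w' p q := by
    intro p hp
    have h1 : rk v' p q = rk v p q := by rcases hv with rfl | rfl <;> simp [rk_mul_swap hp]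
    have h2 : rk w' p q = rk w p q := by rcases hw with rfl | rfl <;> simp [rk_mul_swap hp]
    rw [h1, h2]
    exact h p q
  by_cases hp : p = i + 1
  · subst hp
    have h1 := hne i (by omega)
    have h2 := hne (i + 2) (by omega)
    rw [rk_succ, rk_succ, rk_succ w', rk_succ w'] at h2
    rw [rk_succ, rk_succ w']
    split_ifs at h2 ⊢ <;> omega
  · exact hne p hp

theorem rk_mul_swap_le {σ : Perm ℕ} {i : ℕ} (hd : σ (i + 1) < σ i) (p q : ℕ) :
    rk (σ * swap i (i + 1)) p q ≤ rk σ p q :=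
  rk_le_of_descent (v := σ) (w := σ) (fun _ _ => le_rfl) (Or.inr rfl) (Or.inl rfl) hd p q

theorem rk_mul_swap_lt {σ : Perm ℕ} {i : ℕ} (hd : σ (i + 1) < σ i) :
    rk (σ * swap i (i + 1)) (i + 1) (σ i) < rk σ (i + 1) (σ i) := by
  rw [rk_succ, rk_succ, rk_mul_swap (by omega)]
  simp [hd]

/-! ### Noncrossing inversions -/

/-- The noncrossing inversions of a permutation. -/
def IsInv (σ : Perm ℕ) (a b : ℕ) : Prop := a < b ∧ IsNC (σ * swap a b) ∧ σ b < σ a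

/-- An inversion that involves the position `i + 1` must be `(i, i + 1)`: in any other case `σ *
swap a b` has a step whose interval ought to be stable and contains `i`, but `i` still goes to `σ
i`, outside of that interval. -/
theorem isInv_insertFixed_mul_swap {i : ℕ} {w σ : Perm ℕ} (hw : IsNC w)
    (hσ : σ = insertFixed i w * swap i (i + 1)) (hd : i < σ i) (a b : ℕ) :
    IsInv σ a b ↔ (a = i ∧ b = i + 1) ∨
      ∃ c d, a = skip (i + 1) c ∧ b = skip (i + 1) d ∧ IsInv w c d := by
  have hsucc : σ (i + 1) = i := by rw [hσ, insertFixed_mul_swap_succ]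
  have hskip : ∀ j, σ (skip (i + 1) j) = skip i (w j) := fun j => by
    rw [hσ, insertFixed_mul_swap_skip]
  have key : ∀ c d, IsInv σ (skip (i + 1) c) (skip (i + 1) d) ↔ IsInv w c d := by
    intro c d
    have h1 : ∀ c, swap i (i + 1) (skip (i + 1) c) = skip i c := fun c => by
      have := insertFixed_mul_swap_skip i 1 c
      simpa [insertFixed_one] using this
    have h2 : σ * swap (skip (i + 1) c) (skip (i + 1) d)
        = insertFixed i (w * swap c d) * swap i (i + 1) := by
      rw [hσ, mul_assoc, mul_swap_eq_swap_mul, h1, h1, ← mul_assoc, insertFixed_mul,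
        insertFixed_swap]
    rw [IsInv, IsInv, h2, isNC_insertFixed_mul_swap, hskip, hskip, skip_lt_skip, skip_lt_skip]
  constructor
  · intro h
    rcases eq_or_exists_skip (i + 1) a with rfl | ⟨c, rfl⟩
    · obtain ⟨h1, h2, h3⟩ := h
      have h4 := (h2.1 (i + 1) i (by simpa [hsucc] using h3) (by omega)).2
      rw [Perm.mul_apply, swap_apply_of_ne_of_ne (by omega) (by omega)] at h4
      omega
    · rcases eq_or_exists_skip (i + 1) b with rfl | ⟨d, rfl⟩
      · obtain ⟨h1, h2, h3⟩ := h
        refine Or.inl ⟨?_, rfl⟩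
        by_contra hne
        have h4 := (h2.2 (skip (i + 1) c) i (by omega) (by simp [hsucc])).2
        rw [Perm.mul_apply, swap_apply_of_ne_of_ne (Ne.symm hne) (by omega), Perm.mul_apply,
          swap_apply_left, hsucc] at h4
        omega
      · exact Or.inr ⟨c, d, rfl, rfl, (key c d).mp h⟩
  · rintro (⟨rfl, rfl⟩ | ⟨c, d, rfl, rfl, h⟩)
    · refine ⟨Nat.lt_succ_self _, ?_, by omega⟩
      rw [hσ, mul_assoc, swap_mul_self, mul_one, isNC_insertFixed]
      exact hw
    · exact (key c d).mpr h

/-- An inversion `(i, b)` with `b > i + 1` would create a step from `b` down to `i`, across `i + 1`,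
whose image is below `i`. An inversion `(a, i)` would create a stable interval `[a, i]` that `i`
leaves. -/
theorem isInv_insertFixed {i : ℕ} {w σ : Perm ℕ} (hw : IsNC w)
    (hσ : σ = insertFixed i w) (hd : σ (i + 1) < i) (a b : ℕ) :
    IsInv σ a b ↔ (a = i ∧ b = i + 1) ∨
      ∃ c d, a = skip i c ∧ b = skip i d ∧ IsInv w c d := by
  have hself : σ i = i := by rw [hσ, insertFixed_self]
  have hskip : ∀ j, σ (skip i j) = skip i (w j) := fun j => by rw [hσ, insertFixed_skip]
  have key : ∀ c d, IsInv σ (skip i c) (skip i d) ↔ IsInv w c d := by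
    intro c d
    have h2 : σ * swap (skip i c) (skip i d) = insertFixed i (w * swap c d) := by
      rw [hσ, insertFixed_mul, insertFixed_swap]
    rw [IsInv, IsInv, h2, isNC_insertFixed, hskip, hskip, skip_lt_skip, skip_lt_skip]
  constructor
  · intro h
    rcases eq_or_exists_skip i a with rfl | ⟨c, rfl⟩
    · obtain ⟨h1, h2, h3⟩ := h
      refine Or.inl ⟨rfl, ?_⟩
      by_contra hne
      have h4 := (h2.1 b (a + 1) (by simp [hself]) (by omega)).1
      rw [Perm.mul_apply, Perm.mul_apply, swap_apply_right,
        swap_apply_of_ne_of_ne (by omega) (by omega)] at h4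
      omega
    · rcases eq_or_exists_skip i b with rfl | ⟨d, rfl⟩
      · obtain ⟨h1, h2, h3⟩ := h
        have h4 := (h2.2 (skip b c) b (by omega) (by simp [hself])).2
        rw [Perm.mul_apply, Perm.mul_apply, swap_apply_right, swap_apply_left] at h4
        omega
      · exact Or.inr ⟨c, d, rfl, rfl, (key c d).mp h⟩
  · rintro (⟨rfl, rfl⟩ | ⟨c, d, rfl, rfl, h⟩)
    · refine ⟨Nat.lt_succ_self _, ?_, by omega⟩
      rw [hσ, isNC_insertFixed_mul_swap]
      exact hw
    · exact (key c d).mpr h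

/-! ### Backward cycles and products over blocks -/

theorem backCycle_apply_of_notMem {B : Finset ℕ} {a : ℕ} (h : a ∉ B) : backCycle B a = a :=
  List.formPerm_apply_of_notMem (by simpa using h)

theorem backCycle_apply_mem {B : Finset ℕ} {a : ℕ} (h : a ∈ B) : backCycle B a ∈ B := by
  have := List.formPerm_apply_mem_of_mem (x := a) (l := B.sort (· ≥ ·)) (by simpa using h)
  exact (Finset.mem_sort _).mp this

/-- `b` is the image of `a` under the backward cycle of `B`. -/
def IsBackStep (B : Finset ℕ) (a b : ℕ) : Prop :=
  (b < a ∧ ∀ c ∈ B, ¬ (b < c ∧ c < a)) ∨ ∀ c ∈ B, a ≤ c ∧ c ≤ b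

theorem isBackStep_backCycle {B : Finset ℕ} {a : ℕ} (h : a ∈ B) :
    IsBackStep B a (backCycle B a) := by
  unfold backCycle
  have hnd : (B.sort (· ≥ ·)).Nodup := Finset.sort_nodup _ _
  have hs : (B.sort (· ≥ ·)).Pairwise (· ≥ ·) := Finset.pairwise_sort _ _
  have hmem : ∀ c, c ∈ B ↔ c ∈ B.sort (· ≥ ·) := fun c => (Finset.mem_sort _).symm
  generalize B.sort (· ≥ ·) = l at hnd hs hmem
  have hlt : ∀ (p q : ℕ) (hp : p < l.length) (hq : q < l.length), p < q → l[q] < l[p] := by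
    intro p q hp hq hpq
    refine lt_of_le_of_ne (List.pairwise_iff_getElem.mp hs p q hp hq hpq) fun h => ?_
    have := (hnd.getElem_inj_iff).mp h
    omega
  obtain ⟨k, hk, rfl⟩ := List.getElem_of_mem ((hmem a).mp h)
  by_cases hk1 : k + 1 < l.length
  · rw [List.formPerm_apply_lt_getElem _ hnd _ hk1]
    refine Or.inl ⟨hlt _ _ _ _ (by omega), fun c hc hcc => ?_⟩
    obtain ⟨m, hm, rfl⟩ := List.getElem_of_mem ((hmem c).mp hc)
    rcases Nat.lt_or_ge k m with h1 | h1
    · rcases (show k + 1 ≤ m from h1).eq_or_lt with h2 | h2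
      · subst h2; omega
      · have := hlt _ _ hk1 hm h2; omega
    · rcases h1.eq_or_lt with h2 | h2
      · subst h2; omega
      · have := hlt _ _ hm hk h2; omega
  · rw [List.formPerm_apply_getElem _ hnd]
    have h0 : (k + 1) % l.length = 0 := by
      rw [show k + 1 = l.length by omega, Nat.mod_self]
    simp only [h0]
    refine Or.inr fun c hc => ?_
    obtain ⟨m, hm, rfl⟩ := List.getElem_of_mem ((hmem c).mp hc)
    constructor
    · rcases (show m ≤ k by omega).eq_or_lt with h2 | h2
      · subst h2; exact le_rfl
      · exact (hlt _ _ hm hk h2).le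
    · rcases (Nat.zero_le m).eq_or_lt with h2 | h2
      · subst h2; exact le_rfl
      · exact (hlt _ _ (by omega) hm h2).le

/-- To identify a permutation with a backward cycle on `B`, it is therefore enough to check that it
preserves `B` and makes backward steps. -/
theorem IsBackStep.unique {B : Finset ℕ} {a b c : ℕ} (hb : b ∈ B) (hc : c ∈ B)
    (h1 : IsBackStep B a b) (h2 : IsBackStep B a c) : b = c := by
  rcases h1 with ⟨h1, h1'⟩ | h1 <;> rcases h2 with ⟨h2, h2'⟩ | h2
  · have := h1' c hc
    have := h2' b hb
    omega
  · have := h2 b hb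
    omega
  · have := h1 c hc
    omega
  · have := h1 c hc
    have := h2 b hb
    omega

theorem prod_map_backCycle_of_notMem {l : List (Finset ℕ)} {a : ℕ} (h : ∀ B ∈ l, a ∉ B) :
    (l.map backCycle).prod a = a := by
  induction l with
  | nil => rfl
  | cons C l ih =>
    rw [List.map_cons, List.prod_cons, Perm.mul_apply,
      ih fun B hB => h B (List.mem_cons_of_mem _ hB),
      backCycle_apply_of_notMem (h C List.mem_cons_self)]

theorem prod_map_backCycle_of_mem {l : List (Finset ℕ)} (hl : l.Pairwise Disjoint) {B : Finset ℕ}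
    (hB : B ∈ l) {a : ℕ} (ha : a ∈ B) : (l.map backCycle).prod a = backCycle B a := by
  induction l with
  | nil => simp at hB
  | cons C l ih =>
    rw [List.pairwise_cons] at hl
    rw [List.map_cons, List.prod_cons, Perm.mul_apply]
    rcases List.mem_cons.mp hB with rfl | hB
    · rw [prod_map_backCycle_of_notMem fun D hD h => Finset.disjoint_left.mp (hl.1 D hD) ha h]
    · rw [ih hl.2 hB, backCycle_apply_of_notMem]
      exact fun h => Finset.disjoint_left.mp (hl.1 B hB) h (backCycle_apply_mem ha)

theorem permOfBlocks_apply_of_notMem {P : Finset (Finset ℕ)} {a : ℕ} (h : ∀ B ∈ P, a ∉ B) :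
    permOfBlocks P a = a :=
  prod_map_backCycle_of_notMem (by simpa using h)

theorem permOfBlocks_apply_of_mem {P : Finset (Finset ℕ)}
    (hP : (P : Set (Finset ℕ)).Pairwise Disjoint)
    {B : Finset ℕ} (hB : B ∈ P) {a : ℕ} (ha : a ∈ B) : permOfBlocks P a = backCycle B a := by
  refine prod_map_backCycle_of_mem ?_ (by simpa using hB) ha
  refine P.nodup_toList.pairwise_of_forall_ne fun C hC D hD h => ?_
  exact hP (by simpa using hC) (by simpa using hD) h

/-! ### The two descriptions of noncrossing permutations -/

theorem isNC_of_mem_NC {n : ℕ} {σ : Perm ℕ} (h : σ ∈ NC n) : IsNC σ ∧ ∀ a, n ≤ a → σ a = a := by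
  obtain ⟨P, hP, rfl⟩ := h
  have hout : ∀ a, n ≤ a → permOfBlocks P.parts a = a := fun a ha =>
    permOfBlocks_apply_of_notMem fun B hB haB => by
      have := P.le hB haB
      simp at this
      omega
  have hdis : (P.parts : Set (Finset ℕ)).Pairwise Disjoint := P.disjoint
  have hstep : ∀ a < n, ∃ B ∈ P.parts, a ∈ B ∧ permOfBlocks P.parts a ∈ B ∧
      IsBackStep B a (permOfBlocks P.parts a) := by
    intro a ha
    obtain ⟨B, hB, haB⟩ := P.exists_mem (Finset.mem_range.mpr ha)
    rw [permOfBlocks_apply_of_mem hdis hB haB]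
    exact ⟨B, hB, haB, backCycle_apply_mem haB, isBackStep_backCycle haB⟩
  refine ⟨⟨fun j k h1 h2 => ?_, fun j k h1 h2 => ?_⟩, hout⟩
  · have hj : j < n := by
      by_contra hj
      rw [hout j (by omega)] at h1
      omega
    obtain ⟨B, hB, hjB, hsB, hst⟩ := hstep j hj
    obtain ⟨C, hC, hkC, htC, -⟩ := hstep k (by omega)
    rcases hst with ⟨h3, h4⟩ | h3
    · have hkB : k ∉ B := fun hk => h4 k hk ⟨h1, h2⟩
      have hBC : B ≠ C := fun h => hkB (h ▸ hkC)
      have hne : ∀ b ∈ B, permOfBlocks P.parts k ≠ b := fun b hb h =>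
        Finset.disjoint_left.mp (hdis hB hC hBC) hb (h ▸ htC)
      have h5 := hP C hC B hB hBC.symm _ htC _ hkC _ hsB _ hjB
      have h6 := hP B hB C hC hBC _ hsB _ hjB _ hkC _ htC
      have h7 := hne _ hjB
      have h8 := hne _ hsB
      omega
    · have := h3 _ hjB
      omega
  · rcases h1.eq_or_lt with rfl | h1
    · omega
    by_cases hj : j < n
    · obtain ⟨B, hB, hjB, hsB, hst⟩ := hstep j hj
      have hmax : ∀ c ∈ B, j ≤ c ∧ c ≤ permOfBlocks P.parts j := by
        rcases hst with ⟨h3, -⟩ | h3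
        · omega
        · exact h3
      have hk : k < n := by
        have := P.le hB hsB
        simp at this
        omega
      obtain ⟨C, hC, hkC, htC, -⟩ := hstep k hk
      by_cases hBC : B = C
      · subst hBC
        exact hmax _ htC
      · have hne : ∀ b ∈ B, permOfBlocks P.parts k ≠ b := fun b hb h =>
          Finset.disjoint_left.mp (hdis hB hC hBC) hb (h ▸ htC)
        have hkB : ∀ b ∈ B, k ≠ b := fun b hb h =>
          Finset.disjoint_left.mp (hdis hB hC hBC) hb (h ▸ hkC)
        have h5 := hP C hC B hB (Ne.symm hBC) _ htC _ hkC _ hjB _ hsB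
        have h6 := hP B hB C hC hBC _ hjB _ hsB _ hkC _ htC
        have h7 := hne _ hjB
        have h8 := hne _ hsB
        have h9 := hkB _ hsB
        omega
    · rw [hout j (by omega)] at h2
      omega

/-- An injective map of a finite set into itself is onto, so `S` is stable under negative powers as
well. -/
theorem mem_of_sameCycle_of_stable {σ : Perm ℕ} {S : Set ℕ} (hS : S.Finite)
    (h : ∀ a ∈ S, σ a ∈ S) {a b : ℕ} (ha : a ∈ S) (hab : σ.SameCycle a b) : b ∈ S := by
  obtain ⟨m, rfl⟩ := hab
  have hbij : Set.BijOn σ S S := by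
    refine ⟨h, σ.injective.injOn, ?_⟩
    have heq := Set.eq_of_subset_of_ncard_le (Set.image_subset_iff.mpr h)
      (Set.ncard_image_of_injective S σ.injective).ge hS
    exact heq.ge
  exact (hbij.perm_zpow m).mapsTo ha

/-- The stable intervals of `IsNC` are unions of cycles: the one below a descending step misses the
cycle of `a`, and the one over an ascending step contains it. -/
theorem IsNC.isBackStep {σ : Perm ℕ} (h : IsNC σ) {B : Finset ℕ} {a : ℕ}
    (hB : ∀ b ∈ B, σ.SameCycle a b) : IsBackStep B a (σ a) := by
  rcases Nat.lt_or_ge (σ a) a with h1 | h1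
  · refine Or.inl ⟨h1, fun c hc hcc => ?_⟩
    have := mem_of_sameCycle_of_stable (S := Set.Ioo (σ a) a) (Set.finite_Ioo _ _)
      (fun k hk => h.1 a k hk.1 hk.2) hcc (hB c hc).symm
    exact absurd this.2 (lt_irrefl _)
  · refine Or.inr fun c hc => ?_
    exact mem_of_sameCycle_of_stable (S := Set.Icc a (σ a)) (Set.finite_Icc _ _)
      (fun k hk => h.2 a k hk.1 hk.2) ⟨le_rfl, h1⟩ (hB c hc)

theorem mem_NC_of_isNC {n : ℕ} {σ : Perm ℕ} (h : IsNC σ) (hn : ∀ a, n ≤ a → σ a = a) :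
    σ ∈ NC n := by
  classical
  let P : Finpartition (Finset.range n) := Finpartition.ofSetSetoid (Perm.SameCycle.setoid σ) _
  have hcyc : ∀ B ∈ P.parts, ∀ a ∈ B, ∀ b, b ∈ B ↔ b < n ∧ σ.SameCycle a b := by
    intro B hB a ha b
    rw [← P.part_eq_of_mem hB ha, Finpartition.mem_part_ofSetSetoid_iff_rel]
    have := P.le hB ha
    simp only [this, Finset.mem_range, true_and]
    rfl
  have hlt : ∀ a < n, σ a < n := by
    intro a ha
    by_contra hc
    have := σ.injective (hn (σ a) (by omega))
    omega
  have hmem : ∀ B ∈ P.parts, ∀ a ∈ B, σ a ∈ B := by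
    intro B hB a ha
    rw [hcyc B hB a ha]
    exact ⟨hlt a (by simpa using P.le hB ha),
      Perm.sameCycle_apply_right.mpr (Perm.SameCycle.refl _ _)⟩
  refine ⟨P, ?_, ?_⟩
  · intro B hB C hC hBC a ha b hb c hc d hd hcr
    -- For a crossing `a < c < b < d`, take the first element `e` of `B` after `c`. It steps down to
    -- below `c`, so the stable interval between contains `c`, hence `d`, although `e ≤ b < d`.
    obtain ⟨e, ⟨heB, hce⟩, hmin⟩ : ∃ e, (e ∈ B ∧ c < e) ∧ ∀ k, k < e → ¬ (k ∈ B ∧ c < k) := by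
      have hex : ∃ e, e ∈ B ∧ c < e := ⟨b, hb, hcr.2.1⟩
      exact ⟨Nat.find hex, Nat.find_spec hex, fun k hk => Nat.find_min hex hk⟩
    have heb : e ≤ b := by
      by_contra hc'
      exact hmin b (by omega) ⟨hb, hcr.2.1⟩
    have hse := hmem B hB e heB
    have hdisj := Finset.disjoint_left.mp (P.disjoint hB hC hBC)
    rcases h.isBackStep (B := B) (a := e) (fun k hk => ((hcyc B hB e heB k).mp hk).2) with
      ⟨h1, h2⟩ | h1
    · have h3 : σ e < c := by
        have h4 : σ e ≠ c := fun h => hdisj hse (h ▸ hc)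
        have h5 := hmin _ h1
        have h6 : ¬ c < σ e := fun h => h5 ⟨hse, h⟩
        omega
      have h7 := mem_of_sameCycle_of_stable (S := Set.Ioo (σ e) e) (Set.finite_Ioo _ _)
        (fun k hk => h.1 e k hk.1 hk.2) ⟨h3, hce⟩ ((hcyc C hC c hc d).mp hd).2
      have := h7.2
      omega
    · have := h1 a ha
      omega
  · ext a
    by_cases ha : a < n
    · obtain ⟨B, hB, haB⟩ := P.exists_mem (Finset.mem_range.mpr ha)
      rw [permOfBlocks_apply_of_mem P.disjoint hB haB]
      exact (h.isBackStep fun b hb => ((hcyc B hB a haB b).mp hb).2).unique (hmem B hB a haB)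
        (backCycle_apply_mem haB) (isBackStep_backCycle haB)
    · rw [hn a (by omega),
        permOfBlocks_apply_of_notMem fun B hB haB => ha (by simpa using P.le hB haB)]

theorem mem_NC_iff {n : ℕ} {σ : Perm ℕ} : σ ∈ NC n ↔ IsNC σ ∧ ∀ a, n ≤ a → σ a = a :=
  ⟨isNC_of_mem_NC, fun h => mem_NC_of_isNC h.1 h.2⟩

theorem mem_invNC_iff {n : ℕ} {σ : Perm ℕ} (hn : ∀ a, n ≤ a → σ a = a) (p : ℕ × ℕ) :
    p ∈ invNC n σ ↔ IsInv σ p.1 p.2 := by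
  simp only [invNC, Finset.mem_filter, Finset.mem_product, Finset.mem_range, mem_NC_iff, IsInv]
  constructor
  · rintro ⟨-, h1, ⟨h2, -⟩, h3⟩
    exact ⟨h1, h2, h3⟩
  · rintro ⟨h1, h2, h3⟩
    -- A fixed `p.2 ≥ n` with `σ p.2 < σ p.1` would make `σ p.1` a fixed point too, so that `p.1 = σ
    -- p.1 > p.2`.
    have hlt : p.2 < n := by
      by_contra hc
      have h4 := hn p.2 (by omega)
      have h5 : σ (σ p.1) = σ p.1 := hn _ (by omega)
      have := σ.injective h5
      omega
    refine ⟨⟨by omega, hlt⟩, h1, ⟨h2, fun a ha => ?_⟩, h3⟩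
    rw [Perm.mul_apply, swap_apply_of_ne_of_ne (by omega) (by omega), hn a ha]

/-! ### Terminal nodes of a tree -/

/-- `i` is the left leaf of a terminal node of the tree whose leaves are `a, a + 1, …`. -/
def IsTerm : PlaneTree → ℕ → ℕ → Prop
  | .nil, _, _ => False
  | .node _ l r, a, i =>
      (l = .nil ∧ r = .nil ∧ i = a) ∨ IsTerm l a i ∨ IsTerm r (a + l.numLeaves) i

theorem IsTerm.bounds {T : PlaneTree} {a i : ℕ} (h : IsTerm T a i) :
    a ≤ i ∧ i < a + T.numNodes := by
  induction T generalizing a with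
  | nil => exact h.elim
  | node _ l r hl hr =>
    rw [BinaryTree.numNodes]
    rcases h with ⟨rfl, rfl, rfl⟩ | h | h
    · simp
    · have := hl h
      omega
    · have := hr h
      have := l.numLeaves_eq_numNodes_succ
      omega

theorem trimTree_of_not_isTerm {T : PlaneTree} {a i : ℕ} (h : ¬ IsTerm T a i) :
    trimTree T a i = T := by
  induction T generalizing a with
  | nil => rfl
  | node _ l r hl hr =>
    simp only [IsTerm, not_or] at h
    rw [trimTree, if_neg h.1, hl h.2.1, hr h.2.2]

theorem trimTree_node_left {l r : PlaneTree} {a i : ℕ} (h : IsTerm l a i) :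
    trimTree (.node () l r) a i = .node () (trimTree l a i) r := by
  have hr : ¬ IsTerm r (a + l.numLeaves) i := fun hr => by
    have := hr.bounds
    have := h.bounds
    have := l.numLeaves_eq_numNodes_succ
    omega
  rw [trimTree, if_neg, trimTree_of_not_isTerm hr]
  rintro ⟨rfl, -⟩
  exact h

theorem trimTree_node_right {l r : PlaneTree} {a i : ℕ} (h : IsTerm r (a + l.numLeaves) i) :
    trimTree (.node () l r) a i = .node () l (trimTree r (a + l.numLeaves) i) := by
  have hl : ¬ IsTerm l a i := fun hl => by
    have := hl.bounds
    have := h.bounds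
    have := l.numLeaves_eq_numNodes_succ
    omega
  rw [trimTree, if_neg, trimTree_of_not_isTerm hl]
  rintro ⟨-, rfl, -⟩
  exact h

theorem trimTree_node_nil (a : ℕ) : trimTree (.node () .nil .nil) a a = .nil := by
  simp [trimTree]

theorem numNodes_trimTree {T : PlaneTree} {a i : ℕ} (h : IsTerm T a i) :
    (trimTree T a i).numNodes + 1 = T.numNodes := by
  induction T generalizing a with
  | nil => exact h.elim
  | node _ l r hl hr =>
    rcases h with ⟨rfl, rfl, rfl⟩ | h | h
    · simp [trimTree]
    · rw [trimTree_node_left h]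
      have := hl h
      simp only [BinaryTree.numNodes]
      omega
    · rw [trimTree_node_right h]
      have := hr h
      simp only [BinaryTree.numNodes]
      omega

theorem numLeaves_trimTree {T : PlaneTree} {a i : ℕ} (h : IsTerm T a i) :
    (trimTree T a i).numLeaves + 1 = T.numLeaves := by
  rw [BinaryTree.numLeaves_eq_numNodes_succ, numNodes_trimTree h,
    BinaryTree.numLeaves_eq_numNodes_succ]

theorem exists_isTerm {T : PlaneTree} (h : T ≠ .nil) (a : ℕ) : ∃ i, IsTerm T a i := by
  induction T generalizing a with
  | nil => exact absurd rfl h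
  | node _ l r hl hr =>
    by_cases h1 : l = .nil
    · by_cases h2 : r = .nil
      · exact ⟨a, Or.inl ⟨h1, h2, rfl⟩⟩
      · obtain ⟨i, hi⟩ := hr h2 (a + l.numLeaves)
        exact ⟨i, Or.inr (Or.inr hi)⟩
    · obtain ⟨i, hi⟩ := hl h1 a
      exact ⟨i, Or.inr (Or.inl hi)⟩

theorem isTerm_succ {T : PlaneTree} {a i : ℕ} : IsTerm T (a + 1) (i + 1) ↔ IsTerm T a i := by
  induction T generalizing a with
  | nil => rfl
  | node _ l r hl hr =>
    simp only [IsTerm, add_right_comm a 1, hl, hr, Nat.add_right_cancel_iff]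

theorem trimTree_succ (T : PlaneTree) (a i : ℕ) : trimTree T (a + 1) (i + 1) = trimTree T a i := by
  induction T generalizing a with
  | nil => rfl
  | node _ l r hl hr =>
    simp only [trimTree, add_right_comm a 1, hl, hr, Nat.add_right_cancel_iff]

/-- Trimming at `k` removes one leaf, so the labels to its right drop by one. -/
theorem isTerm_trimTree_of_lt {T : PlaneTree} {a k i : ℕ} (h : IsTerm T a k) (hk : k < i) :
    IsTerm (trimTree T a k) a i ↔ IsTerm T a (i + 1) := by
  induction T generalizing a with
  | nil => exact h.elim
  | node _ l r hl hr =>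
    have hb : ∀ {T a i}, IsTerm T a i → a ≤ i ∧ i < a + T.numNodes := fun h => h.bounds
    have hn := l.numLeaves_eq_numNodes_succ
    rcases h with ⟨rfl, rfl, rfl⟩ | h | h
    · rw [trimTree_node_nil]
      simp only [IsTerm, or_false, true_and, false_iff]
      omega
    · rw [trimTree_node_left h]
      have h1 := hb h
      have h2 : a + l.numLeaves = a + (trimTree l a k).numLeaves + 1 := by
        rw [← numLeaves_trimTree h]; omega
      have h3 : l ≠ .nil := by rintro rfl; exact h
      rw [IsTerm, IsTerm, hl h, h2, isTerm_succ]
      have h4 : i ≠ a := by omega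
      simp [h3, h4]
    · rw [trimTree_node_right h]
      have h1 := hb h
      rw [IsTerm, IsTerm, hr h]
      have h2 : i ≠ a := by omega
      have h3 : i + 1 ≠ a := by omega
      have h4 : ¬ IsTerm l a i := fun h => by have := hb h; omega
      have h5 : ¬ IsTerm l a (i + 1) := fun h => by have := hb h; omega
      simp [h2, h3, h4, h5]

theorem isTerm_of_trimTree_eq_nil {T : PlaneTree} {a i : ℕ} (h : IsTerm T a i)
    (hT : trimTree T a i = .nil) : i = a := by
  have h1 := numNodes_trimTree h
  rw [hT] at h1
  have := h.bounds
  simp at h1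
  omega

theorem isTerm_trimTree_of_gt {T : PlaneTree} {a k i : ℕ} (h : IsTerm T a (i + 1)) (hk : k < i) :
    IsTerm (trimTree T a (i + 1)) a k ↔ IsTerm T a k := by
  induction T generalizing a with
  | nil => exact h.elim
  | node _ l r hl hr =>
    have hb : ∀ {T a i}, IsTerm T a i → a ≤ i ∧ i < a + T.numNodes := fun h => h.bounds
    have hn := l.numLeaves_eq_numNodes_succ
    rcases h with ⟨rfl, rfl, rfl⟩ | h | h
    · rw [trimTree_node_nil]
      simp only [IsTerm, or_false, true_and, false_iff]
      omega
    · rw [trimTree_node_left h]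
      have h1 := hb h
      have h2 := numLeaves_trimTree h
      have h3 : l ≠ .nil := by rintro rfl; exact h
      rw [IsTerm, IsTerm, hl h]
      have h4 : ¬ (trimTree l a (i + 1) = .nil ∧ r = .nil ∧ k = a) := fun h5 => by
        have := isTerm_of_trimTree_eq_nil h h5.1
        omega
      have h6 : ¬ IsTerm r (a + l.numLeaves) k := fun h => by have := hb h; omega
      have h7 : ¬ IsTerm r (a + (trimTree l a (i + 1)).numLeaves) k := fun h => by
        have := hb h; omega
      simp [h3, h4, h6, h7]
    · rw [trimTree_node_right h]
      have h1 := hb h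
      rw [IsTerm, IsTerm, hr h]
      have h3 : r ≠ .nil := by rintro rfl; exact h
      have h4 : ¬ (l = .nil ∧ trimTree r (a + l.numLeaves) (i + 1) = .nil ∧ k = a) := fun h5 => by
        have := isTerm_of_trimTree_eq_nil h h5.2.1
        have : l.numNodes = 0 := by rw [h5.1]; rfl
        omega
      simp [h3, h4]

theorem trimTree_comm {T : PlaneTree} {a k i : ℕ} (hk : IsTerm T a k) (hi : IsTerm T a (i + 1))
    (hki : k < i) :
    trimTree (trimTree T a k) a i = trimTree (trimTree T a (i + 1)) a k := by
  induction T generalizing a with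
  | nil => exact hk.elim
  | node _ l r hl hr =>
    have hb : ∀ {T a i}, IsTerm T a i → a ≤ i ∧ i < a + T.numNodes := fun h => h.bounds
    have hn := l.numLeaves_eq_numNodes_succ
    rcases hk with ⟨rfl, rfl, rfl⟩ | hk | hk <;> rcases hi with ⟨hl0, hr0, h⟩ | hi | hi
    · omega
    · exact hi.elim
    · exact hi.elim
    · subst hl0; exact hk.elim
    · rw [trimTree_node_left hk, trimTree_node_left hi,
        trimTree_node_left ((isTerm_trimTree_of_lt hk hki).mpr hi),
        trimTree_node_left ((isTerm_trimTree_of_gt hi hki).mpr hk), hl hk hi]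
    · have h2 : a + l.numLeaves = a + (trimTree l a k).numLeaves + 1 := by
        rw [← numLeaves_trimTree hk]; omega
      have h3 := hi
      rw [h2, isTerm_succ] at h3
      rw [trimTree_node_left hk, trimTree_node_right hi, trimTree_node_left hk,
        trimTree_node_right h3, h2, trimTree_succ]
    · subst hr0; exact hk.elim
    · have := hb hk
      have := hb hi
      omega
    · rw [trimTree_node_right hk, trimTree_node_right hi,
        trimTree_node_right ((isTerm_trimTree_of_lt hk hki).mpr hi),
        trimTree_node_right ((isTerm_trimTree_of_gt hi hki).mpr hk), hr hk hi]

/-! ### The noncrossing permutation of a tree -/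

/-- The product of the backward cycles of the trees into which `LTree.cut` splits a tree with
leaves `a, a + 1, …`. -/
def treePerm : Bool → PlaneTree → ℕ → Perm ℕ
  | _, .nil, _ => 1
  | b, .node _ l r, a =>
      (if b then 1 else swap (a + l.numNodes) (a + l.numLeaves + r.numNodes)) *
        (treePerm false l a * treePerm true r (a + l.numLeaves))

theorem treePerm_apply_of_not_mem (b : Bool) {T : PlaneTree} {a j : ℕ}
    (h : j < a ∨ a + T.numNodes < j) : treePerm b T a j = j := by
  induction T generalizing a b with
  | nil => rfl
  | node _ l r hl hr =>
    have hn := l.numLeaves_eq_numNodes_succ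
    rw [BinaryTree.numNodes] at h
    rw [treePerm, Perm.mul_apply, Perm.mul_apply, hr _ (by omega), hl _ (by omega)]
    cases b
    · rw [if_neg (by simp), swap_apply_of_ne_of_ne (by omega) (by omega)]
    · simp

/-- On a right child, the cuts isolate the last leaf; only a node further up can join it to a block.
-/
theorem treePerm_true_last (T : PlaneTree) (a : ℕ) :
    treePerm true T a (a + T.numNodes) = a + T.numNodes := by
  induction T generalizing a with
  | nil => rfl
  | node _ l r hl hr =>
    have hn := l.numLeaves_eq_numNodes_succ
    have h1 : a + (l.numNodes + r.numNodes + 1) = a + l.numLeaves + r.numNodes := by omega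
    rw [treePerm, Perm.mul_apply, Perm.mul_apply, BinaryTree.numNodes, h1, hr,
      treePerm_apply_of_not_mem _ (by omega)]
    simp

/-- Shifting all labels by one amounts to inserting a fixed point to the left of the tree. -/
theorem treePerm_succ {i a : ℕ} (b : Bool) (T : PlaneTree) (h : i ≤ a) :
    treePerm b T (a + 1) = insertFixed i (treePerm b T a) := by
  induction T generalizing a b with
  | nil => exact (insertFixed_one i).symm
  | node _ l r hl hr =>
    rw [treePerm, treePerm, insertFixed_mul, insertFixed_mul, hl _ h,
      add_right_comm a 1 l.numLeaves, hr _ (by omega)]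
    congr 1
    cases b
    · have h1 : ∀ j, i ≤ j → skip i j = j + 1 := fun j hj => if_neg (by omega)
      simp only [Bool.false_eq_true, if_false, insertFixed_swap]
      rw [h1 _ (by omega), h1 _ (by omega)]
      congr 1 <;> omega
    · simp [insertFixed_one]

theorem treePerm_eq_insertFixed {i a : ℕ} (b : Bool) (T : PlaneTree) (h : a + T.numNodes < i) :
    treePerm b T a = insertFixed i (treePerm b T a) := by
  ext j
  rcases eq_or_exists_skip i j with rfl | ⟨k, rfl⟩
  · rw [insertFixed_self, treePerm_apply_of_not_mem _ (Or.inr h)]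
  · rw [insertFixed_skip]
    rcases Nat.lt_or_ge (a + T.numNodes) k with hk | hk
    · rw [treePerm_apply_of_not_mem _ (Or.inr hk), treePerm_apply_of_not_mem]
      right
      unfold skip
      split_ifs <;> omega
    · have h1 : skip i k = k := if_pos (by omega)
      have h2 : treePerm b T a k < i := by
        by_contra hc
        have h3 : treePerm b T a (treePerm b T a k) = treePerm b T a k :=
          treePerm_apply_of_not_mem _ (by omega)
        have := (treePerm b T a).injective h3
        omega
      rw [h1]
      exact (if_pos h2).symm

theorem commute_swap_of_fixed {π : Perm ℕ} {i j : ℕ} (hi : π i = i) (hj : π j = j) :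
    swap i j * π = π * swap i j := by
  rw [mul_swap_eq_swap_mul, hi, hj]

/-- If the terminal node is a right child, the leaf `i` is split off as a fixed point. Otherwise `i`
and `i + 1` are joined by the transposition of that node, which commutes with everything contributed
by subtrees further to the right. -/
theorem treePerm_trimTree {T : PlaneTree} {a i : ℕ} (h : IsTerm T a i) (b : Bool) :
    treePerm b T a = insertFixed i (treePerm b (trimTree T a i) a) ∨
      treePerm b T a = insertFixed i (treePerm b (trimTree T a i) a) * swap i (i + 1) := by
  induction T generalizing a b with
  | nil => exact h.elim
  | node _ l r hl hr =>
    have hn := l.numLeaves_eq_numNodes_succ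
    rcases h with ⟨rfl, rfl, rfl⟩ | h | h
    · rw [trimTree_node_nil]
      cases b <;> simp [treePerm, insertFixed_one]
    · have hb := h.bounds
      have h1 := numNodes_trimTree h
      have h2 := numLeaves_trimTree h
      rw [trimTree_node_left h, treePerm, treePerm, insertFixed_mul, insertFixed_mul]
      have h3 : treePerm true r (a + l.numLeaves) =
          insertFixed i (treePerm true r (a + (trimTree l a i).numLeaves)) := by
        rw [← treePerm_succ _ _ (by omega)]
        congr 1
        omega
      have h4 : (if b then (1 : Perm ℕ) else
            swap (a + l.numNodes) (a + l.numLeaves + r.numNodes)) =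
          insertFixed i (if b then (1 : Perm ℕ) else swap (a + (trimTree l a i).numNodes)
            (a + (trimTree l a i).numLeaves + r.numNodes)) := by
        cases b
        · have h1 : ∀ j, i ≤ j → skip i j = j + 1 := fun j hj => if_neg (by omega)
          simp only [Bool.false_eq_true, if_false, insertFixed_swap]
          rw [h1 _ (by omega), h1 _ (by omega)]
          congr 1 <;> omega
        · simp [insertFixed_one]
      have h5 : swap i (i + 1) * treePerm true r (a + l.numLeaves) =
          treePerm true r (a + l.numLeaves) * swap i (i + 1) :=
        commute_swap_of_fixed (treePerm_apply_of_not_mem _ (by omega))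
          (treePerm_apply_of_not_mem _ (by omega))
      rcases hl h false with h6 | h6
      · left
        rw [← h6, ← h3, h4]
      · right
        rw [h6, mul_assoc (insertFixed i (treePerm false (trimTree l a i) a)), h5, ← h3, h4]
        simp only [mul_assoc]
    · have hb := h.bounds
      have h1 := numNodes_trimTree h
      rw [trimTree_node_right h, treePerm, treePerm, insertFixed_mul, insertFixed_mul,
        ← treePerm_eq_insertFixed _ _ (by omega)]
      have h4 : (if b then (1 : Perm ℕ) else
            swap (a + l.numNodes) (a + l.numLeaves + r.numNodes)) =
          insertFixed i (if b then (1 : Perm ℕ) else swap (a + l.numNodes)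
            (a + l.numLeaves + (trimTree r (a + l.numLeaves) i).numNodes)) := by
        cases b
        · have h1 : ∀ j, i ≤ j → skip i j = j + 1 := fun j hj => if_neg (by omega)
          have h2 : ∀ j, j < i → skip i j = j := fun j hj => if_pos (by omega)
          simp only [Bool.false_eq_true, if_false, insertFixed_swap]
          rw [h2 _ (by omega), h1 _ (by omega)]
          congr 1
          omega
        · simp [insertFixed_one]
      rcases hr h true with h6 | h6
      · left
        rw [← h6, h4]
      · right
        rw [h6, h4]
        simp only [mul_assoc]

/-- The exception is the terminal node at the end of a right spine, where `i` and the last leaf `i +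
1` are both fixed so far. The first enclosing node that is not a right child joins `i + 1` to a
smaller leaf, and `i` becomes trimmable. -/
theorem isTrimmable_treePerm {T : PlaneTree} {a i : ℕ} (h : IsTerm T a i) (b : Bool) :
    IsTrimmable (treePerm b T a) i ∨
      (b = true ∧ i + 1 = a + T.numNodes ∧ treePerm b T a i = i) := by
  induction T generalizing a b with
  | nil => exact h.elim
  | node _ l r hl hr =>
    have hn := l.numLeaves_eq_numNodes_succ
    obtain ⟨S, hS⟩ : ∃ S : Perm ℕ, S = if b then (1 : Perm ℕ) else
        swap (a + l.numNodes) (a + l.numLeaves + r.numNodes) := ⟨_, rfl⟩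
    have hSfix : ∀ j, j ≠ a + l.numNodes → j ≠ a + l.numLeaves + r.numNodes → S j = j := by
      intro j h1 h2
      rw [hS]
      cases b
      · rw [if_neg (by simp), swap_apply_of_ne_of_ne h1 h2]
      · simp
    have hval : ∀ j, treePerm b (.node () l r) a j =
        S (treePerm false l a (treePerm true r (a + l.numLeaves) j)) := fun j => by
      rw [treePerm, ← hS]; rfl
    rcases h with ⟨rfl, rfl, rfl⟩ | h | h
    · cases b
      · left; left
        simp [treePerm]
      · right
        simp [treePerm]
    · left
      have hb := h.bounds
      have h1 : treePerm true r (a + l.numLeaves) i = i := treePerm_apply_of_not_mem _ (by omega)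
      have h2 : treePerm true r (a + l.numLeaves) (i + 1) = i + 1 :=
        treePerm_apply_of_not_mem _ (by omega)
      rcases (hl h false).resolve_right (by simp) with ⟨h3, h4⟩ | ⟨h3, h4⟩
      · left
        rw [hval, hval, h1, h2, h3, hSfix i (by omega) (by omega)]
        refine ⟨rfl, ?_⟩
        by_cases h5 : treePerm false l a i = a + l.numNodes ∨
            treePerm false l a i = a + l.numLeaves + r.numNodes
        · rw [hS]
          cases b
          · rcases h5 with h5 | h5 <;> rw [h5] <;> simp <;> omega
          · simpa using h4
        · rw [not_or] at h5
          rw [hSfix _ h5.1 h5.2]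
          exact h4
      · right
        rw [hval, hval, h1, h2, h3, hSfix i (by omega) (by omega), hSfix _ (by omega) (by omega)]
        exact ⟨rfl, h4⟩
    · have hb := h.bounds
      have hlfix : ∀ j, a + l.numLeaves ≤ j → treePerm false l a j = j := fun j hj =>
        treePerm_apply_of_not_mem _ (by omega)
      have hlast := treePerm_true_last r (a + l.numLeaves)
      rcases hr h true with (⟨h3, h4⟩ | ⟨h3, h4⟩) | ⟨-, h3, h4⟩
      · left; left
        have h5 : treePerm true r (a + l.numLeaves) i ≠ a + l.numLeaves + r.numNodes := fun h5 => by
          have := (treePerm true r (a + l.numLeaves)).injective (h5.trans hlast.symm)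
          omega
        rw [hval, hval, h3, hlfix i (by omega), hlfix _ (by omega), hSfix i (by omega) (by omega),
          hSfix _ (by omega) h5]
        exact ⟨rfl, h4⟩
      · left; right
        have h5 : a + l.numLeaves ≤ treePerm true r (a + l.numLeaves) (i + 1) := by
          by_contra hc
          have h6 : treePerm true r (a + l.numLeaves) (treePerm true r (a + l.numLeaves) (i + 1)) =
            treePerm true r (a + l.numLeaves) (i + 1) := treePerm_apply_of_not_mem _ (by omega)
          have := (treePerm true r (a + l.numLeaves)).injective h6
          omega
        rw [hval, hval, h3, hlfix i (by omega), hlfix _ h5, hSfix i (by omega) (by omega),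
          hSfix _ (by omega) (by omega)]
        exact ⟨rfl, h4⟩
      · have h6 : treePerm b (.node () l r) a i = i := by
          rw [hval, h4, hlfix i (by omega), hSfix i (by omega) (by omega)]
        cases b
        · left; right
          refine ⟨h6, ?_⟩
          rw [hval, h3, hlast, hlfix _ (by omega), hS]
          simp
          omega
        · right
          refine ⟨rfl, ?_, h6⟩
          rw [BinaryTree.numNodes]
          omega

/-! ### Indexed forests as right combs -/

/-- The right comb whose left subtrees are the first `K` trees of a sequence. -/
def comb : (ℕ → PlaneTree) → ℕ → PlaneTree
  | _, 0 => .nil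
  | f, K + 1 => .node () (f 0) (comb (fun k => f (k + 1)) K)

/-- The number of leaves of the first `k` trees of a sequence. -/
def leafCount (f : ℕ → PlaneTree) (k : ℕ) : ℕ := ∑ j ∈ Finset.range k, (f j).numLeaves

theorem leafCount_succ (f : ℕ → PlaneTree) (k : ℕ) :
    leafCount f (k + 1) = leafCount f k + (f k).numLeaves := Finset.sum_range_succ _ _

theorem leafCount_succ' (f : ℕ → PlaneTree) (k : ℕ) :
    leafCount f (k + 1) = (f 0).numLeaves + leafCount (fun k => f (k + 1)) k := by
  rw [leafCount, Finset.sum_range_succ', add_comm]; rfl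

theorem le_leafCount (f : ℕ → PlaneTree) (k : ℕ) : k ≤ leafCount f k := by
  induction k with
  | zero => exact Nat.zero_le _
  | succ k ih =>
    have := (f k).numLeaves_pos
    rw [leafCount_succ]
    omega

theorem leafCount_add_le {f : ℕ → PlaneTree} {k m : ℕ} (h : k < m) :
    leafCount f k + (f k).numLeaves ≤ leafCount f m := by
  rw [← leafCount_succ]
  exact Finset.sum_le_sum_of_subset (Finset.range_mono h)

theorem comb_congr {f g : ℕ → PlaneTree} {K : ℕ} (h : ∀ k < K, f k = g k) :
    comb f K = comb g K := by
  induction K generalizing f g with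
  | zero => rfl
  | succ K ih => rw [comb, comb, h 0 (by omega), ih fun k hk => h (k + 1) (by omega)]

theorem eq_of_comb_eq {f g : ℕ → PlaneTree} {K : ℕ} (h : comb f K = comb g K) :
    ∀ k < K, f k = g k := by
  induction K generalizing f g with
  | zero => intro k hk; omega
  | succ K ih =>
    rw [comb, comb] at h
    injection h with _ h1 h2
    rintro (_ | k) hk
    · exact h1
    · exact ih h2 k (by omega)

theorem numNodes_comb (f : ℕ → PlaneTree) (K : ℕ) : (comb f K).numNodes = leafCount f K := by
  induction K generalizing f with
  | zero => rfl
  | succ K ih =>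
    rw [comb, BinaryTree.numNodes, ih, leafCount_succ', BinaryTree.numLeaves_eq_numNodes_succ]
    omega

/-- The second alternative is the lowest node of the spine, which is terminal if the last tree is
trivial; it is not a node of the forest. -/
theorem isTerm_comb {f : ℕ → PlaneTree} {K a i : ℕ} : IsTerm (comb f K) a i ↔
    (∃ k < K, IsTerm (f k) (a + leafCount f k) i) ∨
      ∃ k, K = k + 1 ∧ f k = .nil ∧ i = a + leafCount f k := by
  induction K generalizing f a with
  | zero => simp [comb, IsTerm]
  | succ K ih =>
    rw [comb, IsTerm, ih]
    constructor
    · rintro (⟨h1, h2, h3⟩ | h | ⟨k, hk, h⟩ | ⟨k, rfl, h1, h2⟩)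
      · cases K with
        | zero => exact Or.inr ⟨0, rfl, h1, by simpa [leafCount] using h3⟩
        | succ K => rw [comb] at h2; cases h2
      · exact Or.inl ⟨0, by omega, by simpa [leafCount] using h⟩
      · exact Or.inl ⟨k + 1, by omega, by rwa [leafCount_succ', ← add_assoc]⟩
      · exact Or.inr ⟨k + 1, rfl, h1, by rw [leafCount_succ']; omega⟩
    · rintro (⟨_ | k, hk, h⟩ | ⟨k, hk, h1, h2⟩)
      · exact Or.inr (Or.inl (by simpa [leafCount] using h))
      · refine Or.inr (Or.inr (Or.inl ⟨k, by omega, ?_⟩))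
        rwa [leafCount_succ', ← add_assoc] at h
      · obtain rfl : K = k := by omega
        cases K with
        | zero => exact Or.inl ⟨h1, rfl, by simpa [leafCount] using h2⟩
        | succ K =>
          refine Or.inr (Or.inr (Or.inr ⟨K, rfl, h1, ?_⟩))
          rw [leafCount_succ'] at h2
          omega

theorem trimTree_comb {f : ℕ → PlaneTree} {K a i k : ℕ} (hk : k < K)
    (h : IsTerm (f k) (a + leafCount f k) i) :
    trimTree (comb f K) a i = comb (fun k => trimTree (f k) (a + leafCount f k) i) K := by
  induction K generalizing f a k with
  | zero => omega
  | succ K ih =>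
    rw [comb, comb]
    cases k with
    | zero =>
      have h0 : leafCount f 0 = 0 := rfl
      rw [h0, add_zero] at h
      rw [trimTree_node_left h]
      congr 1
      refine comb_congr fun k _ => (trimTree_of_not_isTerm fun h' => ?_).symm
      have h1 := h'.bounds
      have h2 := h.bounds
      have h3 := (f 0).numLeaves_eq_numNodes_succ
      rw [leafCount_succ'] at h1
      omega
    | succ k =>
      have h1 : IsTerm (f (k + 1))
          (a + (f 0).numLeaves + leafCount (fun k => f (k + 1)) k) i := by
        rwa [leafCount_succ', ← add_assoc] at h
      rw [trimTree_node_right (isTerm_comb.mpr (Or.inl ⟨k, by omega, h1⟩)),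
        ih (f := fun k => f (k + 1)) (by omega : k < K) h1]
      congr 1
      · refine (trimTree_of_not_isTerm fun h' => ?_).symm
        have h2 := h'.bounds
        have h3 := h1.bounds
        have h4 := (f 0).numLeaves_eq_numNodes_succ
        have h5 : leafCount f 0 = 0 := rfl
        omega
      · refine comb_congr fun k _ => ?_
        simp only [leafCount_succ', ← add_assoc]

/-- Spine nodes count as right children, so they contribute no transposition, and the length of the
comb does not matter. -/
theorem treePerm_comb_succ {f : ℕ → PlaneTree} {K : ℕ} (h : f K = .nil) (a : ℕ) :
    treePerm true (comb f (K + 1)) a = treePerm true (comb f K) a := by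
  induction K generalizing f a with
  | zero => simp [comb, h, treePerm]
  | succ K ih =>
    have h1 := ih (f := fun k => f (k + 1)) h (a + (f 0).numLeaves)
    change treePerm true (.node () (f 0) (comb (fun k => f (k + 1)) (K + 1))) a =
      treePerm true (.node () (f 0) (comb (fun k => f (k + 1)) K)) a
    rw [treePerm, treePerm, h1]
    simp

namespace IndexedForest

/-- All trees of the forest from the `K`-th on are trivial. -/
def TrivialFrom (F : IndexedForest) (K : ℕ) : Prop := ∀ k, K ≤ k → F.tree k = .nil

theorem exists_trivialFrom (F : IndexedForest) : ∃ K, F.TrivialFrom K := by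
  obtain ⟨K, hK⟩ := F.finite.bddAbove
  refine ⟨K + 1, fun k hk => ?_⟩
  by_contra h
  have := hK h
  omega

variable {F : IndexedForest} {K i k : ℕ}

theorem TrivialFrom.trim (h : F.TrivialFrom K) (i : ℕ) : (F.trim i).TrivialFrom K := fun k hk => by
  change trimTree (F.tree k) (F.start k) i = .nil
  rw [h k hk, trimTree_nil]

theorem start_eq (F : IndexedForest) (k : ℕ) : F.start k = leafCount F.tree k := rfl

theorem exists_internal_iff (T : PlaneTree) (a i : ℕ) :
    (∃ v ∈ (label T a).internal, v.IsTerminal ∧ v.flag = i) ↔ IsTerm T a i := by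
  induction T generalizing a with
  | nil => simp [label, LTree.internal, IsTerm]
  | node _ l r hl hr =>
    have hroot : (LTree.IsTerminal (.node (label l a) (label r (a + l.numLeaves))) ∧
        (LTree.node (label l a) (label r (a + l.numLeaves))).flag = i) ↔
        (l = .nil ∧ r = .nil ∧ i = a) := by
      cases l <;> cases r <;> simp [label, LTree.IsTerminal, LTree.flag, eq_comm]
    rw [IsTerm, ← hl, ← hr, ← hroot]
    simp only [label, LTree.internal, List.mem_cons, List.mem_append]
    constructor
    · rintro ⟨v, rfl | hv | hv, h⟩
      · exact Or.inl h
      · exact Or.inr (Or.inl ⟨v, hv, h⟩)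
      · exact Or.inr (Or.inr ⟨v, hv, h⟩)
    · rintro (h | ⟨v, hv, h⟩ | ⟨v, hv, h⟩)
      · exact ⟨_, Or.inl rfl, h⟩
      · exact ⟨v, Or.inr (Or.inl hv), h⟩
      · exact ⟨v, Or.inr (Or.inr hv), h⟩

theorem mem_qdes_iff_exists : i ∈ F.qdes ↔ ∃ k, IsTerm (F.tree k) (F.start k) i := by
  simp only [qdes, Set.mem_ofPred_eq, labelled, exists_internal_iff]

/-- With `K + 1` trees the last one is certainly trivial, so the terminal node of the spine always
exists and has left leaf `leafCount F.tree K`; the bound on `i` excludes exactly this one. -/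
theorem mem_qdes_iff (h : F.TrivialFrom K) :
    i ∈ F.qdes ↔ IsTerm (comb F.tree (K + 1)) 0 i ∧ i < leafCount F.tree K := by
  rw [mem_qdes_iff_exists, isTerm_comb]
  simp only [zero_add, start_eq]
  constructor
  · rintro ⟨k, hk⟩
    have hkK : k < K := by
      by_contra hc
      rw [h k (by omega)] at hk
      exact hk
    refine ⟨Or.inl ⟨k, by omega, hk⟩, ?_⟩
    have h1 := hk.bounds
    have h2 := leafCount_add_le (f := F.tree) hkK
    have h3 := (F.tree k).numLeaves_eq_numNodes_succ
    omega
  · rintro ⟨⟨k, -, hk⟩ | ⟨k, hk, -, rfl⟩, h1⟩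
    · exact ⟨k, hk⟩
    · obtain rfl : K = k := by omega
      omega

theorem comb_trim (h : F.TrivialFrom K) (hi : i ∈ F.qdes) :
    comb (F.trim i).tree (K + 1) = trimTree (comb F.tree (K + 1)) 0 i := by
  obtain ⟨k, hk⟩ := mem_qdes_iff_exists.mp hi
  have hkK : k < K := by
    by_contra hc
    rw [h k (by omega)] at hk
    exact hk
  rw [trimTree_comb (k := k) (by omega) (by rwa [zero_add])]
  simp only [zero_add]
  rfl

theorem leafCount_trim (h : F.TrivialFrom K) (hi : i ∈ F.qdes) :
    leafCount (F.trim i).tree K + 1 = leafCount F.tree K := by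
  have h1 := numNodes_trimTree ((mem_qdes_iff h).mp hi).1
  rw [← comb_trim h hi, numNodes_comb, numNodes_comb, leafCount_succ, leafCount_succ,
    h K le_rfl, h.trim i K le_rfl] at h1
  omega

theorem mem_qdes_trim_of_lt (hk : k ∈ F.qdes) (hki : k < i) :
    i ∈ (F.trim k).qdes ↔ i + 1 ∈ F.qdes := by
  obtain ⟨K, h⟩ := F.exists_trivialFrom
  have h1 := leafCount_trim h hk
  rw [mem_qdes_iff (h.trim k), mem_qdes_iff h, comb_trim h hk,
    isTerm_trimTree_of_lt ((mem_qdes_iff h).mp hk).1 hki, ← h1, Nat.add_lt_add_iff_right]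

theorem mem_qdes_trim_of_gt (hi : i + 1 ∈ F.qdes) (hki : k < i) :
    k ∈ (F.trim (i + 1)).qdes ↔ k ∈ F.qdes := by
  obtain ⟨K, h⟩ := F.exists_trivialFrom
  have h1 := leafCount_trim h hi
  have h2 := (mem_qdes_iff h).mp hi
  rw [mem_qdes_iff (h.trim _), mem_qdes_iff h, comb_trim h hi,
    isTerm_trimTree_of_gt h2.1 hki, and_congr_right_iff]
  omega

theorem trim_comm (hk : k ∈ F.qdes) (hi : i + 1 ∈ F.qdes) (hki : k < i) :
    (F.trim k).trim i = (F.trim (i + 1)).trim k := by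
  obtain ⟨K, h⟩ := F.exists_trivialFrom
  have h1 : comb ((F.trim k).trim i).tree (K + 1) =
      comb ((F.trim (i + 1)).trim k).tree (K + 1) := by
    rw [comb_trim (h.trim k) ((mem_qdes_trim_of_lt hk hki).mpr hi), comb_trim h hk,
      comb_trim (h.trim (i + 1)) ((mem_qdes_trim_of_gt hi hki).mpr hk), comb_trim h hi,
      trimTree_comm ((mem_qdes_iff h).mp hk).1 ((mem_qdes_iff h).mp hi).1 hki]
  refine IndexedForest.ext (funext fun m => ?_)
  by_cases hm : m < K + 1
  · exact eq_of_comb_eq h1 m hm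
  · rw [(h.trim k).trim i m (by omega), (h.trim (i + 1)).trim k m (by omega)]

theorem exists_mem_qdes (h : F ≠ empty) : ∃ i, i ∈ F.qdes := by
  have h1 : ∃ k, F.tree k ≠ .nil := by
    by_contra! hc
    exact h (IndexedForest.ext (funext hc))
  obtain ⟨k, hk⟩ := h1
  obtain ⟨i, hi⟩ := exists_isTerm hk (F.start k)
  exact ⟨i, mem_qdes_iff_exists.mpr ⟨k, hi⟩⟩

theorem exists_qdes_bound (F : IndexedForest) : ∃ N, ∀ i, N ≤ i → i ∉ F.qdes := by
  obtain ⟨K, h⟩ := F.exists_trivialFrom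
  refine ⟨leafCount F.tree K, fun i hi hq => ?_⟩
  have := ((mem_qdes_iff h).mp hq).2
  omega

/-- The number of internal nodes of the forest. -/
noncomputable def size (F : IndexedForest) : ℕ :=
  leafCount F.tree F.exists_trivialFrom.choose - F.exists_trivialFrom.choose

theorem TrivialFrom.leafCount_add (h : F.TrivialFrom K) (d : ℕ) :
    leafCount F.tree (K + d) = leafCount F.tree K + d := by
  induction d with
  | zero => rfl
  | succ d ih =>
    rw [← add_assoc, leafCount_succ, ih, h _ (by omega), BinaryTree.numLeaves, add_assoc]

theorem TrivialFrom.size_add (h : F.TrivialFrom K) : F.size + K = leafCount F.tree K := by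
  have h1 := F.exists_trivialFrom.choose_spec
  unfold size
  generalize F.exists_trivialFrom.choose = M at h1
  have h2 := le_leafCount F.tree M
  rcases Nat.le_total K M with h3 | h3
  · obtain ⟨d, rfl⟩ := Nat.exists_eq_add_of_le h3
    rw [h.leafCount_add] at h2 ⊢
    omega
  · obtain ⟨d, rfl⟩ := Nat.exists_eq_add_of_le h3
    rw [h1.leafCount_add]
    omega

theorem size_trim (hi : i ∈ F.qdes) : (F.trim i).size + 1 = F.size := by
  obtain ⟨K, h⟩ := F.exists_trivialFrom
  have h1 := leafCount_trim h hi
  have h2 := h.size_add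
  have h3 := (h.trim i).size_add
  omega

/-- The noncrossing permutation of a forest. -/
noncomputable def perm (F : IndexedForest) : Perm ℕ :=
  treePerm true (comb F.tree F.exists_trivialFrom.choose) 0

theorem TrivialFrom.treePerm_comb_add (h : F.TrivialFrom K) (d : ℕ) :
    treePerm true (comb F.tree (K + d)) 0 = treePerm true (comb F.tree K) 0 := by
  induction d with
  | zero => rfl
  | succ d ih => rw [← add_assoc, treePerm_comb_succ (h _ (by omega)), ih]

theorem TrivialFrom.treePerm_comb (h : F.TrivialFrom K) :
    treePerm true (comb F.tree K) 0 = F.perm := by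
  have h1 := F.exists_trivialFrom.choose_spec
  unfold perm
  generalize F.exists_trivialFrom.choose = M at h1
  rcases Nat.le_total K M with h3 | h3
  · obtain ⟨d, rfl⟩ := Nat.exists_eq_add_of_le h3
    rw [h.treePerm_comb_add]
  · obtain ⟨d, rfl⟩ := Nat.exists_eq_add_of_le h3
    rw [h1.treePerm_comb_add]

theorem perm_empty : empty.perm = 1 := by
  rw [← TrivialFrom.treePerm_comb (F := empty) (K := 0) fun _ _ => rfl]
  rfl

theorem TrivialFrom.mono {M : ℕ} (h : F.TrivialFrom K) (hM : K ≤ M) : F.TrivialFrom M :=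
  fun k hk => h k (by omega)

theorem perm_trim (hi : i ∈ F.qdes) : F.perm = insertFixed i (F.trim i).perm ∨
    F.perm = insertFixed i (F.trim i).perm * swap i (i + 1) := by
  obtain ⟨K, h⟩ := F.exists_trivialFrom
  rw [← (h.mono K.le_succ).treePerm_comb, ← ((h.trim i).mono K.le_succ).treePerm_comb,
    comb_trim h hi]
  exact treePerm_trimTree ((mem_qdes_iff h).mp hi).1 true

theorem isTrimmable_perm (hi : i ∈ F.qdes) : IsTrimmable F.perm i := by
  obtain ⟨K, h⟩ := F.exists_trivialFrom
  rw [← (h.mono K.le_succ).treePerm_comb]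
  have h1 := (mem_qdes_iff h).mp hi
  refine (isTrimmable_treePerm h1.1 true).resolve_right fun h2 => ?_
  have h3 := h2.2.1
  rw [numNodes_comb, leafCount_succ, h K le_rfl, BinaryTree.numLeaves] at h3
  omega

theorem isNC_perm (F : IndexedForest) : IsNC F.perm := by
  induction hs : F.size generalizing F with
  | zero =>
    by_cases h : F = empty
    · rw [h, perm_empty]; exact isNC_one
    · obtain ⟨i, hi⟩ := exists_mem_qdes h
      have := size_trim hi
      omega
  | succ d ih =>
    by_cases h : F = empty
    · rw [h, perm_empty]; exact isNC_one
    · obtain ⟨i, hi⟩ := exists_mem_qdes h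
      have h1 := ih (F.trim i) (by have := size_trim hi; omega)
      rcases perm_trim hi with h2 | h2 <;> rw [h2]
      · exact isNC_insertFixed.mpr h1
      · exact isNC_insertFixed_mul_swap.mpr h1

end IndexedForest

/-! ### Existence and uniqueness of the double forest polynomials -/

theorem IndexedForest.notMem_qdes_empty (i : ℕ) : i ∉ IndexedForest.empty.qdes := by
  rw [IndexedForest.mem_qdes_iff_exists]
  rintro ⟨k, hk⟩
  exact hk

open Classical in
/-- The recursive construction of the double forest polynomials. -/
noncomputable def forestPoly (F : IndexedForest) : PolyTX :=
  if F = IndexedForest.empty then 1 else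
    solve (fun i => if _h : i ∈ F.qdes then omitT i (forestPoly (F.trim i)) else 0)
      -- Taking as many steps as the bound brings the descending recursion to position `0`, so all
      -- `E_i` are prescribed.
      F.exists_qdes_bound.choose F.exists_qdes_bound.choose
termination_by F.size
decreasing_by
  have := IndexedForest.size_trim _h
  omega

open Classical in
/-- The prescribed image of the polynomial of `F` under `E_i`. -/
noncomputable def trimmedPoly (P : IndexedForest → PolyTX) (F : IndexedForest) (i : ℕ) : PolyTX :=
  if i ∈ F.qdes then omitT i (P (F.trim i)) else 0

theorem trimmedPoly_of_mem (P : IndexedForest → PolyTX) {F : IndexedForest} {i : ℕ}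
    (h : i ∈ F.qdes) : trimmedPoly P F i = omitT i (P (F.trim i)) := if_pos h

theorem trimmedPoly_of_notMem (P : IndexedForest → PolyTX) {F : IndexedForest} {i : ℕ}
    (h : i ∉ F.qdes) : trimmedPoly P F i = 0 := if_neg h

theorem forestPoly_empty : forestPoly IndexedForest.empty = 1 := by
  rw [forestPoly, if_pos rfl]

theorem forestPoly_of_ne {F : IndexedForest} (h : F ≠ IndexedForest.empty) :
    forestPoly F = solve (trimmedPoly forestPoly F) F.exists_qdes_bound.choose
      F.exists_qdes_bound.choose := by
  rw [forestPoly, if_neg h]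
  congr 1

/-- The prescribed images satisfy the compatibility condition that makes them solvable. -/
theorem trimDiff_trimmedPoly {P : IndexedForest → PolyTX} {F : IndexedForest}
    (hP : ∀ i ∈ F.qdes, ∀ j, eope j (P (F.trim i)) = trimmedPoly P (F.trim i) j) {k i : ℕ}
    (hki : k < i) : trimDiff i (i + 1) (trimmedPoly P F k) =
      (x i - t (i + 1)) * eope k (trimmedPoly P F (i + 1)) := by
  by_cases hk : k ∈ F.qdes
  · rw [trimmedPoly_of_mem P hk, trimDiff_succ_omitT hki.le, hP k hk]
    by_cases hi : i + 1 ∈ F.qdes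
    · rw [trimmedPoly_of_mem P hi, eope_omitT (by omega), hP _ hi,
        trimmedPoly_of_mem P ((IndexedForest.mem_qdes_trim_of_lt hk hki).mpr hi),
        trimmedPoly_of_mem P ((IndexedForest.mem_qdes_trim_of_gt hi hki).mpr hk),
        omitT_comm hki.le, IndexedForest.trim_comm hk hi hki]
    · rw [trimmedPoly_of_notMem P hi,
        trimmedPoly_of_notMem P (mt (IndexedForest.mem_qdes_trim_of_lt hk hki).mp hi),
        eope_zero, map_zero]
  · rw [trimmedPoly_of_notMem P hk]
    have h0 : trimDiff i (i + 1) 0 = 0 := by simp [trimDiff]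
    rw [h0]
    by_cases hi : i + 1 ∈ F.qdes
    · rw [trimmedPoly_of_mem P hi, eope_omitT (by omega), hP _ hi,
        trimmedPoly_of_notMem P (mt (IndexedForest.mem_qdes_trim_of_gt hi hki).mp hk), map_zero,
        mul_zero]
    · rw [trimmedPoly_of_notMem P hi, eope_zero, mul_zero]

theorem forestPoly_spec (F : IndexedForest) : (forestPoly F).IsHomogeneous F.size ∧
    ∀ i, eope i (forestPoly F) = trimmedPoly forestPoly F i := by
  induction hs : F.size using Nat.strong_induction_on generalizing F with
  | _ d ih =>
    by_cases hF : F = IndexedForest.empty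
    · subst hF
      have h0 : d = 0 := by
        have h := IndexedForest.TrivialFrom.size_add (F := IndexedForest.empty) (K := 0)
          fun _ _ => rfl
        rw [hs] at h
        simpa [leafCount] using h
      rw [forestPoly_empty, h0]
      refine ⟨MvPolynomial.isHomogeneous_one _ _, fun i => ?_⟩
      rw [eope_of_mem_xBelow (one_mem _),
        trimmedPoly_of_notMem _ (IndexedForest.notMem_qdes_empty i)]
    · have hlt : ∀ i ∈ F.qdes, (F.trim i).size + 1 = d := fun i hi =>
        hs ▸ IndexedForest.size_trim hi
      obtain ⟨i₀, hi₀⟩ := IndexedForest.exists_mem_qdes hF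
      obtain ⟨e, rfl⟩ : ∃ e, d = e + 1 := ⟨_, (hlt i₀ hi₀).symm⟩
      have hN := F.exists_qdes_bound.choose_spec
      rw [forestPoly_of_ne hF]
      generalize F.exists_qdes_bound.choose = N at hN
      constructor
      · refine isHomogeneous_solve (fun i => ?_) N N
        by_cases hi : i ∈ F.qdes
        · rw [trimmedPoly_of_mem _ hi]
          exact isHomogeneous_omitT (ih e (by omega) _ (by have := hlt i hi; omega)).1 i
        · rw [trimmedPoly_of_notMem _ hi]
          exact MvPolynomial.isHomogeneous_zero _ _ _
      · intro i
        refine eope_solve (fun i hi => trimmedPoly_of_notMem _ (hN i hi)) (fun k i hki => ?_) le_rfl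
          i (by omega)
        exact trimDiff_trimmedPoly
          (fun i hi => (ih e (by omega) _ (by have := hlt i hi; omega)).2) hki

theorem isDoubleForestFamily_forestPoly : IsDoubleForestFamily forestPoly where
  homogeneous F := ⟨_, (forestPoly_spec F).1⟩
  ev_one_empty := by rw [forestPoly_empty, map_one]
  ev_one F hF := by rw [forestPoly_of_ne hF, ev_one_solve]
  eope_mem F i hi := by rw [(forestPoly_spec F).2, trimmedPoly_of_mem _ hi]
  eope_notMem F i hi := by rw [(forestPoly_spec F).2, trimmedPoly_of_notMem _ hi]

theorem IsDoubleForestFamily.unique {P Q : IndexedForest → PolyTX} (hP : IsDoubleForestFamily P)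
    (hQ : IsDoubleForestFamily Q) : P = Q := by
  funext F
  induction hs : F.size using Nat.strong_induction_on generalizing F with
  | _ d ih =>
    refine sub_eq_zero.mp (eq_zero_of_eope_eq_zero (fun i => ?_) ?_)
    · rw [eope_sub]
      by_cases hi : i ∈ F.qdes
      · rw [hP.eope_mem F i hi, hQ.eope_mem F i hi,
          ih _ (by have := IndexedForest.size_trim hi; omega) (F.trim i) rfl, sub_self]
      · rw [hP.eope_notMem F i hi, hQ.eope_notMem F i hi, sub_self]
    · rw [map_sub]
      by_cases hF : F = IndexedForest.empty
      · rw [hF, hP.ev_one_empty, hQ.ev_one_empty, sub_self]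
      · rw [hP.ev_one F hF, hQ.ev_one F hF, sub_self]

theorem isDoubleForestFamily_doubleForest : IsDoubleForestFamily doubleForest := by
  have h : ∃! P : IndexedForest → PolyTX, IsDoubleForestFamily P :=
    ⟨forestPoly, isDoubleForestFamily_forestPoly, fun _ hQ =>
      hQ.unique isDoubleForestFamily_forestPoly⟩
  rw [doubleForest, dif_pos h]
  exact h.choose_spec.1

/-! ### Evaluations and trimming -/

/-- The evaluation `x_j ↦ t_{w(j)}` with the variable `t_i` left out. -/
noncomputable def evSkip (i : ℕ) (w : Perm ℕ) : PolyTX →ₐ[ℤ] PolyT :=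
  MvPolynomial.aeval (Sum.elim (fun j => MvPolynomial.X (skip i (w j))) MvPolynomial.X)

theorem evSkip_x (i : ℕ) (w : Perm ℕ) (j : ℕ) :
    evSkip i w (x j) = MvPolynomial.X (skip i (w j)) := by
  simp [evSkip, x]

theorem evSkip_t (i : ℕ) (w : Perm ℕ) (j : ℕ) : evSkip i w (t j) = MvPolynomial.X j := by
  simp [evSkip, t]

/-- For `w` given, `m = i` yields `insertFixed i w` and `m = i + 1` its product with the
transposition: the two terms of `trimDiff i i`. -/
theorem ev_eq_evSkip_insertT {i m : ℕ} {w σ : Perm ℕ} (hm : σ m = i)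
    (hσ : ∀ j, σ (skip m j) = skip i (w j)) (f : PolyTX) :
    ev σ f = evSkip i w (insertT m i f) := by
  suffices H : ev σ = (evSkip i w).comp (insertT m i) by rw [H, AlgHom.comp_apply]
  refine polyTX_hom_ext (fun j => ?_) (fun j => by simp [ev_t, evSkip_t])
  rw [AlgHom.comp_apply, ev_x, insertT_x]
  rcases eq_or_exists_skip m j with rfl | ⟨k, rfl⟩
  · simp [hm, evSkip_t]
  · rw [hσ]
    unfold skip
    split_ifs <;> first | omega | simp_all [evSkip_x, skip]

theorem evSkip_omitT (i : ℕ) (w : Perm ℕ) (f : PolyTX) :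
    evSkip i w (omitT i f) = MvPolynomial.rename (skip i) (ev w f) := by
  suffices H : (evSkip i w).comp (omitT i) = (MvPolynomial.rename (skip i)).comp (ev w) by
    rw [← AlgHom.comp_apply, H, AlgHom.comp_apply]
  exact polyTX_hom_ext (fun j => by simp [omitT_x, evSkip_x, ev_x])
    (fun j => by simp [omitT_t, evSkip_t, ev_t])

theorem ev_sub_ev (i : ℕ) (w : Perm ℕ) (f : PolyTX) :
    ev (insertFixed i w * swap i (i + 1)) f - ev (insertFixed i w) f =
      (MvPolynomial.X (skip i (w i)) - MvPolynomial.X i) * evSkip i w (eope i f) := by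
  rw [ev_eq_evSkip_insertT (insertFixed_mul_swap_succ i w) (insertFixed_mul_swap_skip i w),
    ev_eq_evSkip_insertT (insertFixed_self i w) (insertFixed_skip i w), ← map_sub]
  change evSkip i w (trimDiff i i f) = _
  rw [trimDiff_self, map_mul, map_sub, evSkip_x, evSkip_t]

theorem ev_eq_of_ev_eq_zero {f : PolyTX} {i : ℕ} {w σ : Perm ℕ}
    (hσ : σ = insertFixed i w ∨ σ = insertFixed i w * swap i (i + 1))
    (h0 : ev (σ * swap i (i + 1)) f = 0) :
    ev σ f = (MvPolynomial.X (σ i) - MvPolynomial.X (σ (i + 1))) *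
      evSkip i w (eope i f) := by
  have h := ev_sub_ev i w f
  have h2 : skip i i = i + 1 := if_neg (by omega)
  have h3 : skip (i + 1) i = i := if_pos (by omega)
  rcases hσ with rfl | rfl
  · have h1 := insertFixed_skip i w i
    rw [h2] at h1
    rw [h0] at h
    rw [insertFixed_self, h1, ← neg_inj, ← zero_sub, h]
    ring
  · have h1 := insertFixed_mul_swap_skip i w i
    rw [h3] at h1
    rw [mul_assoc, swap_mul_self, mul_one] at h0
    rw [h0, sub_zero] at h
    rw [insertFixed_mul_swap_succ, h1, h]

theorem fixed_of_insertFixed {σ w : Perm ℕ} {i n : ℕ}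
    (h : σ = insertFixed i w ∨ σ = insertFixed i w * swap i (i + 1))
    (hn : ∀ a, n + 1 ≤ a → σ a = a) (hi : i < n) : ∀ a, n ≤ a → w a = a := by
  intro a ha
  have h1 : skip i a = a + 1 := if_neg (by omega)
  have h2 : skip (i + 1) a = a + 1 := if_neg (by omega)
  apply skip_injective i
  rw [h1, ← hn (a + 1) (by omega)]
  rcases h with rfl | rfl
  · rw [← insertFixed_skip, h1]
  · rw [← insertFixed_mul_swap_skip, h2]

theorem IsTrimmable.lt_of_fixed {σ : Perm ℕ} {i n : ℕ} (h : IsTrimmable σ i)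
    (hn : ∀ a, n ≤ a → σ a = a) : i + 1 < n := by
  by_contra hc
  have h1 := hn (i + 1) (by omega)
  rcases h with ⟨h2, h3⟩ | ⟨h2, h3⟩ <;> omega

/-! ### Vanishing of evaluations -/

namespace IsDoubleForestFamily

variable {P : IndexedForest → PolyTX}

/-- The evaluation of a double forest polynomial at a noncrossing permutation vanishes unless the
permutation of the forest is below it in the Bruhat order. -/
theorem rk_perm_le (hP : IsDoubleForestFamily P) {n : ℕ} {σ : Perm ℕ} (hσ : IsNC σ)
    (hn : ∀ a, n ≤ a → σ a = a) {F : IndexedForest} (h : ev σ (P F) ≠ 0) (p q : ℕ) :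
    rk F.perm p q ≤ rk σ p q := by
  have hone : ∀ F, ev 1 (P F) ≠ 0 → ∀ p q, rk F.perm p q ≤ rk 1 p q := by
    intro F h p q
    by_cases hF : F = IndexedForest.empty
    · rw [hF, IndexedForest.perm_empty]
    · exact absurd (hP.ev_one F hF) h
  induction n generalizing σ F p q with
  | zero =>
    obtain rfl : σ = 1 := Equiv.ext fun a => hn a (Nat.zero_le a)
    exact hone F h p q
  | succ n ih =>
    -- The sum of the ranks over a box that is large enough measures the height in Bruhat order; it
    -- drops when a descent is removed.
    induction hM : ∑ z ∈ Finset.range (n + 2) ×ˢ Finset.range (n + 2), rk σ z.1 z.2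
      using Nat.strong_induction_on generalizing σ F p q with
    | _ M ihM =>
      by_cases h1 : σ = 1
      · subst h1; exact hone F h p q
      obtain ⟨i, hi⟩ := hσ.exists_isTrimmable h1
      obtain ⟨w, hw⟩ := hi.exists_insertFixed
      have hin := hi.lt_of_fixed hn
      have hwNC : IsNC w := by
        rcases hw with rfl | rfl
        · exact isNC_insertFixed.mp hσ
        · exact isNC_insertFixed_mul_swap.mp hσ
      -- If the neighbour `σ * swap i (i + 1)` gives zero, the factorisation leads to `w` and `F/i`,
      -- with smaller `n`. If not, the claim for this lower noncrossing permutation suffices.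
      by_cases h0 : ev (σ * swap i (i + 1)) (P F) = 0
      · rw [ev_eq_of_ev_eq_zero hw h0] at h
        have hq : i ∈ F.qdes := by
          by_contra hq
          exact h (by rw [hP.eope_notMem F i hq, map_zero, mul_zero])
        rw [hP.eope_mem F i hq, evSkip_omitT] at h
        have h2 : ev w (P (F.trim i)) ≠ 0 := fun h3 => h (by rw [h3, map_zero, mul_zero])
        exact rk_le_of_descent (rk_insertFixed_mono
          (ih hwNC (fixed_of_insertFixed hw hn (by omega)) h2) i)
          (IndexedForest.perm_trim hq) hw hi.lt p q
      · have hsNC : IsNC (σ * swap i (i + 1)) := by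
          rcases hw with rfl | rfl
          · exact isNC_insertFixed_mul_swap.mpr hwNC
          · rw [mul_assoc, swap_mul_self, mul_one]
            exact isNC_insertFixed.mpr hwNC
        have hsn : ∀ a, n + 1 ≤ a → (σ * swap i (i + 1)) a = a := fun a ha => by
          rw [Perm.mul_apply, swap_apply_of_ne_of_ne (by omega) (by omega), hn a ha]
        have hlt : σ i < n + 2 := by
          by_contra hc
          have := σ.injective (hn (σ i) (by omega))
          omega
        refine (ihM _ ?_ hsNC hsn h0 p q rfl).trans (rk_mul_swap_le hi.lt p q)
        rw [← hM]
        refine Finset.sum_lt_sum (fun z _ => rk_mul_swap_le hi.lt _ _) ⟨(i + 1, σ i), ?_, ?_⟩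
        · simp only [Finset.mem_product, Finset.mem_range]
          omega
        · exact rk_mul_swap_lt hi.lt

/-- This permutation is noncrossing and has strictly smaller rank than `F.perm` at `(i + 1, F.perm
i)`, so it does not dominate `F.perm`. -/
theorem ev_perm_mul_swap (hP : IsDoubleForestFamily P) {F : IndexedForest} {n i : ℕ}
    (hn : ∀ a, n ≤ a → F.perm a = a) (hi : i ∈ F.qdes) :
    ev (F.perm * swap i (i + 1)) (P F) = 0 := by
  by_contra h
  have ht := IndexedForest.isTrimmable_perm hi
  have hin := ht.lt_of_fixed hn
  have hNC : IsNC (F.perm * swap i (i + 1)) := by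
    have hw := IndexedForest.isNC_perm (F.trim i)
    rcases IndexedForest.perm_trim hi with h1 | h1 <;> rw [h1]
    · exact isNC_insertFixed_mul_swap.mpr hw
    · rw [mul_assoc, swap_mul_self, mul_one]
      exact isNC_insertFixed.mpr hw
  have h1 := hP.rk_perm_le (n := n) hNC (fun a ha => by
    rw [Perm.mul_apply, swap_apply_of_ne_of_ne (by omega) (by omega), hn a ha]) h (i + 1)
    (F.perm i)
  have h2 := rk_mul_swap_lt ht.lt
  omega

/-! ### The product formula -/

theorem prod_invNC_of_isInv_iff {n i m : ℕ} {σ w : Perm ℕ} (hn : ∀ a, n ≤ a → σ a = a)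
    (hwn : ∀ a, n ≤ a → w a = a) (hm : m = i ∨ m = i + 1)
    (hinv : ∀ a b, IsInv σ a b ↔ (a = i ∧ b = i + 1) ∨
      ∃ c d, a = skip m c ∧ b = skip m d ∧ IsInv w c d)
    (hskip : ∀ j, σ (skip m j) = skip i (w j)) :
    (∏ p ∈ invNC n σ, (MvPolynomial.X (σ p.1) - MvPolynomial.X (σ p.2) : PolyT)) =
      (MvPolynomial.X (σ i) - MvPolynomial.X (σ (i + 1))) *
        MvPolynomial.rename (skip i)
          (∏ p ∈ invNC n w, (MvPolynomial.X (w p.1) - MvPolynomial.X (w p.2) : PolyT)) := by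
  have hset : invNC n σ =
      insert (i, i + 1) ((invNC n w).image (Prod.map (skip m) (skip m))) := by
    ext ⟨a, b⟩
    rw [mem_invNC_iff hn, hinv]
    simp only [Finset.mem_insert, Prod.mk.injEq, Finset.mem_image, mem_invNC_iff hwn, Prod.exists,
      Prod.map_apply]
    refine or_congr Iff.rfl ⟨?_, ?_⟩
    · rintro ⟨c, d, rfl, rfl, h⟩
      exact ⟨c, d, h, rfl, rfl⟩
    · rintro ⟨c, d, h, rfl, rfl⟩
      exact ⟨c, d, rfl, rfl, h⟩
  rw [hset, Finset.prod_insert, Finset.prod_image, map_prod]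
  · congr 1
    refine Finset.prod_congr rfl fun p _ => ?_
    simp [hskip]
  · exact fun p _ q _ h => ((skip_injective m).prodMap (skip_injective m)) h
  · simp only [Finset.mem_image, Prod.exists, Prod.map_apply, Prod.mk.injEq, not_exists, not_and]
    intro c d _ h1 h2
    rcases hm with rfl | rfl
    · exact skip_ne _ _ h1
    · exact skip_ne _ _ h2

theorem ev_perm (hP : IsDoubleForestFamily P) {F : IndexedForest} {n : ℕ}
    (hn : ∀ a, n ≤ a → F.perm a = a) :
    ev F.perm (P F) = ∏ p ∈ invNC n F.perm,
      (MvPolynomial.X (F.perm p.1) - MvPolynomial.X (F.perm p.2) : PolyT) := by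
  induction hs : F.size using Nat.strong_induction_on generalizing F with
  | _ d ih =>
    by_cases hF : F = IndexedForest.empty
    · subst hF
      rw [IndexedForest.perm_empty, hP.ev_one_empty]
      symm
      refine Finset.prod_eq_one fun p hp => ?_
      have h1 := (mem_invNC_iff (fun _ _ => rfl) p).mp hp
      have h2 := h1.1
      have h3 : p.2 < p.1 := h1.2.2
      omega
    · obtain ⟨i, hi⟩ := IndexedForest.exists_mem_qdes hF
      have ht := IndexedForest.isTrimmable_perm hi
      have hin := ht.lt_of_fixed hn
      have hw := IndexedForest.perm_trim hi
      have hwNC := IndexedForest.isNC_perm (F.trim i)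
      have hwn : ∀ a, n ≤ a → (F.trim i).perm a = a := fun a ha =>
        -- In fact the smaller permutation fixes everything from `n - 1` on; keeping `n` allows both
        -- inversion sets to be taken in the same `[n]`.
        fixed_of_insertFixed (n := n - 1) hw (fun a ha => hn a (by omega)) (by omega) a (by omega)
      rw [ev_eq_of_ev_eq_zero hw (hP.ev_perm_mul_swap hn hi), hP.eope_mem F i hi, evSkip_omitT,
        ih _ (by have := IndexedForest.size_trim hi; omega) hwn rfl]
      symm
      rcases hw with hw | hw
      · have hself : F.perm i = i := by rw [hw, insertFixed_self]
        refine prod_invNC_of_isInv_iff hn hwn (Or.inl rfl)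
          (isInv_insertFixed hwNC hw ?_) fun j => by rw [hw, insertFixed_skip]
        have := ht.lt
        omega
      · have hsucc : F.perm (i + 1) = i := by rw [hw, insertFixed_mul_swap_succ]
        refine prod_invNC_of_isInv_iff hn hwn (Or.inr rfl)
          (isInv_insertFixed_mul_swap hwNC hw ?_) fun j => by rw [hw, insertFixed_mul_swap_skip]
        have := ht.lt
        omega

end IsDoubleForestFamily

/-! ### Comparison with `ForToNC` -/

/-- The trees into which a tree with leaves `a, a + 1, …` is split. -/
def pieces (b : Bool) (T : PlaneTree) (a : ℕ) : List LTree :=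
  ((label T a).cut b).1 :: ((label T a).cut b).2

/-- A deleted right child is replaced by its own right child, which is deleted in turn, until the
rightmost leaf is reached. -/
theorem cut_true_label (T : PlaneTree) (a : ℕ) :
    ((label T a).cut true).1 = .leaf (a + T.numNodes) := by
  induction T generalizing a with
  | nil => rfl
  | node _ l r hl hr =>
    have := l.numLeaves_eq_numNodes_succ
    rw [label, LTree.cut, hr, BinaryTree.numNodes]
    congr 1
    omega

theorem leaves_cut_perm (b : Bool) (T : LTree) :
    ((T.cut b).1.leaves ++ ((T.cut b).2.map LTree.leaves).flatten).Perm T.leaves := by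
  induction T generalizing b with
  | leaf i => cases b <;> simp [LTree.cut, LTree.leaves]
  | node l r hl hr =>
    have h := (hl false).append (hr true)
    cases b <;> simp only [LTree.cut, LTree.leaves, List.map_append, List.flatten_append,
      List.map_cons, List.flatten_cons, List.append_assoc] at h ⊢
    · exact (List.Perm.append_left _ (List.perm_append_comm_assoc _ _ _)).trans h
    · exact (List.perm_append_comm_assoc _ _ _).trans
        ((List.Perm.append_left _ (List.perm_append_comm_assoc _ _ _)).trans h)

theorem leaves_label (T : PlaneTree) (a : ℕ) :
    (label T a).leaves = List.range' a T.numLeaves := by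
  induction T generalizing a with
  | nil => rfl
  | node _ l r hl hr =>
    rw [label, LTree.leaves, hl, hr, BinaryTree.numLeaves, List.range'_append_1]

theorem pieces_leaves_perm (b : Bool) (T : PlaneTree) (a : ℕ) :
    ((pieces b T a).map LTree.leaves).flatten.Perm (List.range' a T.numLeaves) := by
  rw [← leaves_label]
  exact leaves_cut_perm b _

theorem pieces_pairwise_disjoint (b : Bool) (T : PlaneTree) (a : ℕ) :
    ((pieces b T a).map fun S => S.leaves.toFinset).Pairwise Disjoint := by
  have h : ((pieces b T a).map LTree.leaves).flatten.Nodup :=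
    (pieces_leaves_perm b T a).nodup_iff.mpr (List.nodup_range')
  have h1 := (List.nodup_flatten.mp h).2
  rw [List.pairwise_map] at h1 ⊢
  refine h1.imp fun h2 => ?_
  rw [Finset.disjoint_left]
  intro c hc hc'
  exact h2 (List.mem_toFinset.mp hc) (List.mem_toFinset.mp hc')

theorem exists_mem_pieces_iff (b : Bool) (T : PlaneTree) (a c : ℕ) :
    (∃ S ∈ pieces b T a, c ∈ S.leaves) ↔ a ≤ c ∧ c < a + T.numLeaves := by
  rw [← List.mem_range'_1, ← (pieces_leaves_perm b T a).mem_iff]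
  simp

theorem last_mem_cut_false (T : PlaneTree) (a : ℕ) :
    a + T.numNodes ∈ ((label T a).cut false).1.leaves := by
  cases T with
  | nil => simp [label, LTree.cut, LTree.leaves]
  | node _ l r =>
    have := l.numLeaves_eq_numNodes_succ
    rw [label, LTree.cut, LTree.leaves, cut_true_label, BinaryTree.numNodes]
    simp only [LTree.leaves, List.mem_append, List.mem_singleton]
    right
    omega

/-- This explains the transposition in `treePerm`: a node that stays appends the last leaf of its
right subtree to the block of its left child, whose maximum is the last leaf of the left subtree. -/
theorem backCycle_insert {B : Finset ℕ} {m c : ℕ} (hm : m ∈ B) (hB : ∀ b ∈ B, b ≤ m) (hc : m < c) :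
    backCycle (insert c B) = swap m c * backCycle B := by
  have h1 : c ∉ B := fun h => by have := hB c h; omega
  have h2 : (insert c B).sort (· ≥ ·) = c :: B.sort (· ≥ ·) :=
    Finset.sort_insert _ (fun b hb => (hB b hb).trans hc.le) h1
  have h3 : B.sort (· ≥ ·) = m :: (B.erase m).sort (· ≥ ·) := by
    conv_lhs => rw [← Finset.insert_erase hm]
    exact Finset.sort_insert _ (fun b hb => hB b (Finset.mem_of_mem_erase hb))
      (Finset.notMem_erase m B)
  rw [backCycle, backCycle, h2, h3, List.formPerm_cons_cons, swap_comm]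

theorem backCycle_singleton (a : ℕ) : backCycle {a} = 1 := by
  simp [backCycle]

theorem treePerm_eq_prod (b : Bool) (T : PlaneTree) (a : ℕ) :
    treePerm b T a =
      (((pieces b T a).map fun S => S.leaves.toFinset).map backCycle).prod := by
  induction T generalizing a b with
  | nil => cases b <;> simp [pieces, label, LTree.cut, LTree.leaves, treePerm, backCycle_singleton]
  | node _ l r hl hr =>
    have hn := l.numLeaves_eq_numNodes_succ
    have h1 : treePerm true r (a + l.numLeaves) = ((((label r (a + l.numLeaves)).cut true).2.map
        fun S => S.leaves.toFinset).map backCycle).prod := by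
      rw [hr, pieces, cut_true_label, List.map_cons, List.map_cons, List.prod_cons]
      simp [LTree.leaves, backCycle_singleton]
    rw [treePerm, h1, hl]
    cases b
    · have h2 : ∀ c ∈ ((label l a).cut false).1.leaves.toFinset, c ≤ a + l.numNodes := by
        intro c hc
        have := (exists_mem_pieces_iff false l a c).mp
          ⟨_, List.mem_cons_self, List.mem_toFinset.mp hc⟩
        omega
      have h3 := backCycle_insert (c := a + l.numLeaves + r.numNodes)
        (List.mem_toFinset.mpr (last_mem_cut_false l a)) h2 (by omega)
      have h4 : (LTree.node ((label l a).cut false).1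
          ((label r (a + l.numLeaves)).cut true).1).leaves.toFinset =
          insert (a + l.numLeaves + r.numNodes) ((label l a).cut false).1.leaves.toFinset := by
        ext c
        simp [LTree.leaves, cut_true_label]
      simp only [pieces, label, LTree.cut, List.map_cons, List.prod_cons, h4, h3, List.map_append,
        List.prod_append, Bool.false_eq_true, if_false, mul_assoc]
    · simp only [pieces, label, LTree.cut, List.map_cons, List.prod_cons, List.map_append,
        List.prod_append, if_true, one_mul, cut_true_label, mul_assoc]
      simp [LTree.leaves, backCycle_singleton]

theorem mem_pieces_comb {f : ℕ → PlaneTree} {K a : ℕ} {S : LTree} :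
    S ∈ pieces true (comb f K) a ↔ S = .leaf (a + leafCount f K) ∨
      ∃ k < K, S ∈ pieces false (f k) (a + leafCount f k) := by
  induction K generalizing f a with
  | zero => simp [pieces, comb, label, LTree.cut, leafCount]
  | succ K ih =>
    have h1 : S ∈ pieces true (comb f (K + 1)) a ↔ S ∈ pieces false (f 0) a ∨
        S ∈ pieces true (comb (fun k => f (k + 1)) K) (a + (f 0).numLeaves) := by
      simp only [pieces, comb, label, LTree.cut, List.mem_cons, List.mem_append]
      tauto
    rw [h1, ih, leafCount_succ', ← add_assoc]
    constructor
    · rintro (h | rfl | ⟨k, hk, h⟩)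
      · exact Or.inr ⟨0, by omega, by simpa [leafCount] using h⟩
      · exact Or.inl rfl
      · exact Or.inr ⟨k + 1, by omega, by rwa [leafCount_succ', ← add_assoc]⟩
    · rintro (rfl | ⟨_ | k, hk, h⟩)
      · exact Or.inr (Or.inl rfl)
      · exact Or.inl (by simpa [leafCount] using h)
      · refine Or.inr (Or.inr ⟨k, by omega, ?_⟩)
        rwa [leafCount_succ', ← add_assoc] at h

namespace IndexedForest

theorem mem_LC_iff {F : IndexedForest} {S : LTree} :
    S ∈ F.LC ↔ ∃ k, S ∈ pieces false (F.tree k) (leafCount F.tree k) := by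
  simp only [LC, pieces, Set.mem_ofPred_eq, List.mem_cons]
  rfl

/-- A piece of a forest supported on `[n]` either has all its leaves in `[n]` or is a single leaf
outside of `[n]`. -/
theorem leaves_piece {F : IndexedForest} {n k : ℕ} (hF : F ∈ Forest n) {S : LTree}
    (hS : S ∈ pieces false (F.tree k) (leafCount F.tree k)) :
    (∀ c ∈ S.leaves, c < n) ∨ (∃ c, n ≤ c ∧ S = .leaf c) := by
  by_cases h : F.tree k = .nil
  · rw [h] at hS
    simp only [pieces, label, LTree.cut, List.mem_cons, List.not_mem_nil, or_false] at hS
    subst hS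
    rcases Nat.lt_or_ge (leafCount F.tree k) n with h1 | h1
    · left
      simpa [LTree.leaves] using h1
    · exact Or.inr ⟨_, h1, rfl⟩
  · left
    intro c hc
    have h1 := (exists_mem_pieces_iff false (F.tree k) (leafCount F.tree k) c).mp ⟨S, hS, hc⟩
    have h2 : c ∈ F.supp := by
      refine ⟨k, h, ?_⟩
      rw [labelled, leaves_label, start_eq]
      exact List.mem_range'_1.mpr h1
    simpa using hF h2

/-- The finitely many trees of `LC F` that matter for the permutation of `F` on `[n]`. -/
theorem exists_list_LC (F : IndexedForest) (n : ℕ) :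
    ∃ L : List LTree, (L.map fun S => S.leaves.toFinset).Pairwise Disjoint ∧
      F.perm = ((L.map fun S => S.leaves.toFinset).map backCycle).prod ∧
      (∀ S ∈ L, S ∈ F.LC) ∧ (∀ S ∈ F.LC, (∀ c ∈ S.leaves, c < n) → S ∈ L) ∧
      ∀ c < n, ∃ S ∈ L, c ∈ S.leaves := by
  obtain ⟨K₀, hK₀⟩ := F.exists_trivialFrom
  -- Each tree has a leaf, so with `K ≥ n` the first `K` trees cover `[n]` and the later ones lie
  -- outside of it.
  obtain ⟨K, hK, hnK⟩ : ∃ K, F.TrivialFrom K ∧ n ≤ K :=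
    ⟨max K₀ n, hK₀.mono (le_max_left _ _), le_max_right _ _⟩
  refine ⟨pieces true (comb F.tree K) 0, pieces_pairwise_disjoint _ _ _, ?_, ?_, ?_, ?_⟩
  · rw [← hK.treePerm_comb, treePerm_eq_prod]
  · intro S hS
    rw [mem_LC_iff]
    rcases mem_pieces_comb.mp hS with rfl | ⟨k, -, h⟩
    · refine ⟨K, ?_⟩
      rw [hK K le_rfl, zero_add]
      exact List.mem_cons_self
    · exact ⟨k, by rwa [zero_add] at h⟩
  · intro S hS hlt
    obtain ⟨k, hk⟩ := mem_LC_iff.mp hS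
    refine mem_pieces_comb.mpr (Or.inr ⟨k, ?_, by rwa [zero_add]⟩)
    by_contra hc
    rw [hK k (by omega)] at hk
    simp only [pieces, label, LTree.cut, List.mem_cons, List.not_mem_nil, or_false] at hk
    subst hk
    have h1 := hlt (leafCount F.tree k) (by simp [LTree.leaves])
    have h2 := le_leafCount F.tree k
    omega
  · intro c hc
    rw [exists_mem_pieces_iff, BinaryTree.numLeaves_eq_numNodes_succ, numNodes_comb]
    have := le_leafCount F.tree K
    omega

/-- The blocks used by `ForToNC n F` and by `F.perm` can differ only in single leaves outside of
`[n]`, whose cycles are trivial. -/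
theorem forToNC_eq_perm {F : IndexedForest} {n : ℕ} (hF : F ∈ Forest n) :
    ForToNC n F = F.perm ∧ ∀ a, n ≤ a → F.perm a = a := by
  classical
  obtain ⟨L, hdis, hperm, hLC, hmem, hcov⟩ := exists_list_LC F n
  have hbig : ∀ a, n ≤ a → F.perm a = a := by
    intro a ha
    rw [hperm]
    by_cases h : ∃ S ∈ L, a ∈ S.leaves
    · obtain ⟨S, hS, haS⟩ := h
      obtain ⟨k, hk⟩ := mem_LC_iff.mp (hLC S hS)
      rw [prod_map_backCycle_of_mem hdis (List.mem_map_of_mem hS) (List.mem_toFinset.mpr haS)]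
      rcases leaves_piece hF hk with h1 | ⟨c, -, rfl⟩
      · have := h1 a haS
        omega
      · simp [LTree.leaves, backCycle_singleton]
    · push Not at h
      refine prod_map_backCycle_of_notMem fun B hB haB => ?_
      obtain ⟨S, hS, rfl⟩ := List.mem_map.mp hB
      exact h S hS (List.mem_toFinset.mp haB)
  refine ⟨?_, hbig⟩
  have hblock : ∀ B, B ∈ ({B ∈ (Finset.range n).powerset | ∃ T ∈ F.LC, T.leaves.toFinset = B} :
      Finset (Finset ℕ)) → B ∈ L.map (fun S => S.leaves.toFinset) ∧ ∀ c ∈ B, c < n := by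
    intro B hB
    rw [Finset.mem_filter, Finset.mem_powerset] at hB
    obtain ⟨h1, T, hT, rfl⟩ := hB
    have h2 : ∀ c ∈ T.leaves, c < n := fun c hc => by
      simpa using h1 (List.mem_toFinset.mpr hc)
    exact ⟨List.mem_map_of_mem (hmem T hT h2), fun c hc => h2 c (List.mem_toFinset.mp hc)⟩
  ext a
  rcases Nat.lt_or_ge a n with ha | ha
  · obtain ⟨S, hS, haS⟩ := hcov a ha
    have h1 : S.leaves.toFinset ∈ ({B ∈ (Finset.range n).powerset |
        ∃ T ∈ F.LC, T.leaves.toFinset = B} : Finset (Finset ℕ)) := by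
      rw [Finset.mem_filter, Finset.mem_powerset]
      refine ⟨fun c hc => ?_, S, hLC S hS, rfl⟩
      obtain ⟨k, hk⟩ := mem_LC_iff.mp (hLC S hS)
      rcases leaves_piece hF hk with h1 | ⟨c, hc, rfl⟩
      · exact Finset.mem_range.mpr (h1 c (List.mem_toFinset.mp hc))
      · simp only [LTree.leaves, List.mem_singleton] at haS
        omega
    rw [hperm, prod_map_backCycle_of_mem hdis (List.mem_map_of_mem hS) (List.mem_toFinset.mpr haS),
      ForToNC, NCPerm, permOfBlocks_apply_of_mem _ h1 (List.mem_toFinset.mpr haS)]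
    intro B hB C hC hBC
    exact hdis.forall (hblock B hB).1 (hblock C hC).1 hBC
  · rw [hbig a ha, ForToNC, NCPerm, permOfBlocks_apply_of_notMem]
    intro B hB haB
    have := (hblock B hB).2 a haB
    omega

end IndexedForest

end DoubleForest

theorem theorem8p13 (n : ℕ) (F : DoubleForest.IndexedForest) (hF : F ∈ DoubleForest.Forest n)
    (σ : Equiv.Perm ℕ) (hσ : σ = DoubleForest.ForToNC n F) :
    σ ∈ DoubleForest.NC n ∧
    DoubleForest.ev σ (DoubleForest.doubleForest F) =
      ∏ p ∈ DoubleForest.invNC n σ,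
        (MvPolynomial.X (σ p.1) - MvPolynomial.X (σ p.2) : DoubleForest.PolyT) := by
  obtain ⟨h, hn⟩ := DoubleForest.IndexedForest.forToNC_eq_perm hF
  subst hσ
  rw [h]
  exact ⟨DoubleForest.mem_NC_of_isNC F.isNC_perm hn,
    DoubleForest.isDoubleForestFamily_doubleForest.ev_perm hn⟩
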